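/- Let $(X,d)$ be a complete separable metric space and let $E:X\to\mathbb R\cup\{+\infty\}$ be lower semicontinuous, with dense domain $D(E)=\{E<\infty\}$, and bounded from below on every $d$-bounded set. The slope of $E$ is $|\partial E|(x)=+\infty$ if $x\notin D(E)$, and $|\partial E|(x)=\limsup_{y\to x}\frac{[E(x)-E(y)]^+}{d(x,y)}$ if $x\in D(E)$ (with value $0$ if $x$ is isolated). For $\lambda\in\mathbb R$, an $\mathrm{EVI}_\lambda$-gradient flow of $E$ starting from $x\in X$ is a locally absolutely continuous curve $(\gamma_t)_{t>0}$ in $X$ with $\gamma_t\to x$ as $t\downarrow0$ such that for every $y\in X$ $$\tfrac12\tfrac{\mathrm d}{\mathrm dt}d^2(\gamma_t,y)+\tfrac\lambda2 d^2(\gamma_t,y)+E(\gamma_t)\le E(y)\qquad\text{for a.e. }t>0.$$ Assume that for some $\lambda\in\mathbb R$ such a flow exists from every $x\in X$. It is then unique, and we write $S_tx$ for its value at time $t>0$, and $S_0x=x$. For $\gamma\in C([0,1],X)$ and $\varepsilon>0$ put $$\mathcal A(\gamma)=\tfrac12\int_0^1|\dot\gamma_t|^2\,\mathrm dt,\qquad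 \mathcal A_\varepsilon(\gamma)=\mathcal A(\gamma)+\tfrac{\varepsilon^2}2\int_0^1|\partial E|^2(\gamma_t)\,\mathrm dt,$$ where $|\dot\gamma_t|$ is the metric speed and $\mathcal A(\gamma)=+\infty$ if $\gamma$ is not absolutely continuous. Let $x,y\in X$, where $E(x)=+\infty$ or $E(y)=+\infty$ is allowed, let $\varepsilon_n>0$ with $\varepsilon_n\to0$, and let $\eta_n\ge0$ with $\eta_n\to0$ slowly enough that $$\varepsilon_n\big(E(S_{\eta_n}x)+E(S_{\eta_n}y)\big)\to0 .$$ Let $\iota_{01}(\gamma)=0$ if $\gamma_0=x$ and $\gamma_1=y$, and $\iota_{01}(\gamma)=+\infty$ otherwise; let $\iota^n_{01}(\gamma)=0$ if $\gamma_0=S_{\eta_n}x$ and $\gamma_1=S_{\eta_n}y$, and $\iota^n_{01}(\gamma)=+\infty$ otherwise. Then $$\Gamma\text{-}\lim_{n\to\infty}\big\{\mathcal A_{\varepsilon_n}+\iota^n_{01}\big\}=\mathcal A+\iota_{01}$$ with respect to uniform convergence on $C([0,1],X)$. That is: (i) $\mathcal A(\gamma)+\iota_{01}(\gamma)\le\liminf_n\{\mathcal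 A_{\varepsilon_n}(\gamma^n)+\iota_{01}^n(\gamma^n)\}$ whenever $\gamma^n\to\gamma$, and (ii) for every $\gamma\in C([0,1],X)$ there is a sequence $\gamma^n\to\gamma$ with $\limsup_n\{\mathcal A_{\varepsilon_n}(\gamma^n)+\iota_{01}^n(\gamma^n)\}\le\mathcal A(\gamma)+\iota_{01}(\gamma)$. Moreover, let $\sigma$ be any Hausdorff topology on $X$ such that every $d$-bounded sequence has a $\sigma$-converging subsequence (with limit in $X$) and such that $d$ and $|\partial E|$ are sequentially $\sigma$-lower semicontinuous. Then (i) and (ii) also hold when $\gamma^n\to\gamma$ is understood as $\gamma^n_t\to\gamma_t$ in $\sigma$ for every $t\in[0,1]$. -/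

import Mathlib

open Set Filter Topology MeasureTheory
open scoped ENNReal

noncomputable section

namespace MetricSchrodinger

variable {X : Type*} [MetricSpace X]

/-- The slope `|∂E|` of `E : X → ℝ ∪ {+∞}`: it is `+∞` off the domain of `E`, and
`limsup_{y → x, y ≠ x} [E x - E y]⁺ / d(x, y)` on the domain. At an isolated point `𝓝[≠] x` is
the bottom filter, so the `limsup` is `0` there. -/
def slope (E : X → EReal) (x : X) : ℝ≥0∞ :=
  open Classical in
  if E x = ⊤ then ⊤
  else limsup (fun y => (E x - E y).toENNReal / edist x y) (𝓝[≠] x)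

/-- `γ`, restricted to `(0, ∞)`, is a gradient flow of `E` in the `EVI_λ` sense. The function
`s ↦ d²(γ s, y)` is locally absolutely continuous on `(0, ∞)` by the first field, so its derivative
exists at almost every `t > 0`. -/
structure IsEVIFlow (E : X → EReal) (lam : ℝ) (γ : ℝ → X) : Prop where
  locally_ac : ∀ a b : ℝ, 0 < a → a ≤ b → AbsolutelyContinuousOnInterval γ a b
  evi : ∀ y : X, ∀ᵐ t ∂(volume.restrict (Ioi (0 : ℝ))),
    (((1 / 2) * deriv (fun s => dist (γ s) y ^ 2) t + (lam / 2) * dist (γ t) y ^ 2 : ℝ) : EReal)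
      + E (γ t) ≤ E y

/-- `γ` is an `EVI_λ`-gradient flow of `E` starting at `x`. -/
structure IsEVIFlowFrom (E : X → EReal) (lam : ℝ) (x : X) (γ : ℝ → X) : Prop
    extends IsEVIFlow E lam γ where
  tendsto_start : Tendsto γ (𝓝[>] 0) (𝓝 x)

/-- The standing assumptions on `E : X → ℝ ∪ {+∞}`; completeness and separability of `X` are
type class assumptions. -/
structure StandingAssumptions (E : X → EReal) (lam : ℝ) : Prop where
  ne_bot : ∀ x, E x ≠ ⊥
  lsc : LowerSemicontinuous E
  dense_domain : Dense {x | E x ≠ ⊤}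
  bddBelow_of_isBounded : ∀ B : Set X, Bornology.IsBounded B →
    ∃ c : ℝ, ∀ x ∈ B, (c : EReal) ≤ E x
  exists_flow : ∀ x : X, ∃ γ : ℝ → X, IsEVIFlowFrom E lam x γ

/-- The semigroup `S_t x`: the value at time `t > 0` of the (unique) `EVI_λ`-gradient flow of `E`
starting at `x`, and `S_0 x = x`. -/
def semigroup (E : X → EReal) (lam : ℝ) (t : ℝ) (x : X) : X :=
  open Classical in
  if h : 0 < t ∧ ∃ γ : ℝ → X, IsEVIFlowFrom E lam x γ then h.2.choose t else x

/-- The metric speed `|γ̇_t| = lim_{s → t} d(γ_s, γ_t) / |s - t|`. For an absolutely continuous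
curve the limit exists at almost every `t`; the upper limit makes it total. -/
def metricSpeed (γ : ℝ → X) (t : ℝ) : ℝ≥0∞ :=
  limsup (fun s => edist (γ s) (γ t) / edist s t) (𝓝[≠] t)

/-- The space `C([0,1], X)` of curves that are continuous with respect to the distance of `X`. It is
named so that a second topology `σ` on `X` can never be picked up in its place. -/
abbrev Curve (X : Type*) [MetricSpace X] : Type _ := C(unitInterval, X)

/-- A curve `[0,1] → X` as a function on `ℝ`, constant on `(-∞, 0]` and on `[1, ∞)`. -/
def extend (γ : Curve X) : ℝ → X :=
  fun t => γ (projIcc 0 1 zero_le_one t)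

/-- The kinetic energy `½ ∫₀¹ |γ̇_t|² dt`, which is `+∞` if `γ` is not absolutely continuous. -/
def kineticEnergy (γ : Curve X) : ℝ≥0∞ :=
  open Classical in
  if AbsolutelyContinuousOnInterval (extend γ) 0 1 then
    (1 / 2) * ∫⁻ t in Icc (0 : ℝ) 1, metricSpeed (extend γ) t ^ 2
  else ⊤

/-- The halved Fisher information `½ ∫₀¹ |∂E|²(γ_t) dt`. -/
def fisherInformation (E : X → EReal) (γ : Curve X) : ℝ≥0∞ :=
  (1 / 2) * ∫⁻ t in Icc (0 : ℝ) 1, slope E (extend γ t) ^ 2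

/-- The action `A_ε = A + ε² I`. -/
def action (E : X → EReal) (ε : ℝ) (γ : Curve X) : ℝ≥0∞ :=
  kineticEnergy γ + ENNReal.ofReal (ε ^ 2) * fisherInformation E γ

/-- The convex indicator of the constraints `γ_0 = x`, `γ_1 = y`. -/
def endpointIndicator (x y : X) (γ : Curve X) : ℝ≥0∞ :=
  open Classical in
  if γ 0 = x ∧ γ 1 = y then 0 else ⊤

/-- `F` is the (sequential) `Γ`-limit of `Fn n` as `n → ∞` with respect to a notion `conv` of
convergence of sequences: the `Γ`-liminf inequality along every converging sequence, and a
recovery sequence for every point. -/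
def GammaConverges {Z : Type*} (conv : (ℕ → Z) → Z → Prop) (Fn : ℕ → Z → ℝ≥0∞)
    (F : Z → ℝ≥0∞) : Prop :=
  (∀ (u : ℕ → Z) (z : Z), conv u z → F z ≤ liminf (fun n => Fn n (u n)) atTop) ∧
  (∀ z : Z, ∃ u : ℕ → Z, conv u z ∧ limsup (fun n => Fn n (u n)) atTop ≤ F z)

/-- Uniform convergence of curves with respect to the distance of `X`. -/
def UniformConv (u : ℕ → Curve X) (γ : Curve X) : Prop :=
  TendstoUniformly (fun n t => u n t) (fun t => γ t) atTop

/-- Convergence of `d`-continuous curves in the pointwise-in-time `σ`-topology. -/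
def PointwiseConv (σ : TopologicalSpace X) (u : ℕ → Curve X)
    (γ : Curve X) : Prop :=
  ∀ t : unitInterval, Tendsto (fun n => u n t) atTop (@nhds X σ (γ t))

/-- `σ` is a Hausdorff topology on `X` for which every `d`-bounded sequence has a `σ`-converging
subsequence, and `d` and `|∂E|` are sequentially lower semicontinuous. -/
structure SigmaAssumption (E : X → EReal) (σ : TopologicalSpace X) : Prop where
  hausdorff : @T2Space X σ
  seq_compact : ∀ B : Set X, Bornology.IsBounded B → ∀ u : ℕ → X, (∀ n, u n ∈ B) →
    ∃ (z : X) (φ : ℕ → ℕ), StrictMono φ ∧ Tendsto (fun k => u (φ k)) atTop (@nhds X σ z)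
  dist_seq_lsc : ∀ (u v : ℕ → X) (a b : X), Tendsto u atTop (@nhds X σ a) →
    Tendsto v atTop (@nhds X σ b) → edist a b ≤ liminf (fun n => edist (u n) (v n)) atTop
  slope_seq_lsc : ∀ (u : ℕ → X) (a : X), Tendsto u atTop (@nhds X σ a) →
    slope E a ≤ liminf (fun n => slope E (u n)) atTop

end MetricSchrodinger

end

/-!
Integrating the EVI in time shows that the energy decreases along a flow, that the flow contracts
distances up to the factor `exp (-lam * t)`, and that the energy dissipated up to time `t` controls
the squared global slope at time `t`. Kept in the integrated EVI, the dissipation improves it by a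
squared slope term.

A curve `f` has finite kinetic energy iff it has an energy function: a monotone `v` with
`dist (f s) (f t) ^ 2 ≤ (t - s) * (v t - v s)`. This property passes to pointwise limits of `v`
and to lower limits of the distances, which gives the liminf inequality.

For the recovery sequence, let each point `γ t` flow for the time `η + ε * min t (1 - t)`. On either
half of `[0, 1]` the improved EVI, applied to the flow that runs longer, provides an energy function
for the new curve which accounts for the slope as well. Its total increment exceeds that of `γ` only
by a factor tending to `1` and by `ε` times a difference of energies at the end points and at the
midpoint.
-/

namespace MetricSchrodinger

variable {X : Type*} [MetricSpace X]

section PseudoMetric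

variable {Y : Type*} [PseudoMetricSpace Y] {f : ℝ → Y} {a b : ℝ}

theorem absolutelyContinuousOnInterval_dist_const (hf : AbsolutelyContinuousOnInterval f a b)
    (y : Y) : AbsolutelyContinuousOnInterval (fun s => dist (f s) y) a b := by
  rw [absolutelyContinuousOnInterval_iff] at hf ⊢
  intro ε hε
  obtain ⟨δ, hδ, h⟩ := hf ε hε
  exact ⟨δ, hδ, fun I hI hl =>
    (Finset.sum_le_sum fun i _ => dist_dist_dist_le_left _ _ _).trans_lt (h I hI hl)⟩

theorem continuousOn_of_absolutelyContinuousOnInterval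
    (hf : AbsolutelyContinuousOnInterval f a b) : ContinuousOn f (uIcc a b) := by
  intro t ht
  have h := (absolutelyContinuousOnInterval_dist_const hf (f t)).continuousOn t ht
  rw [ContinuousWithinAt, dist_self] at h
  exact tendsto_iff_dist_tendsto_zero.2 h

end PseudoMetric

section RealFunctions

theorem le_of_increment_le_mul {G m : ℝ → ℝ} {a b : ℝ} (hab : a ≤ b)
    (h : ∀ s t, a ≤ s → s ≤ t → t ≤ b → G t - G s ≤ (t - s) * (m s - m t)) : G b ≤ G a := by
  -- On a uniform grid the increments of `m` telescope, and the mesh tends to zero.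
  have grid_bound : ∀ N : ℕ, G b - G a ≤ (b - a) * (m a - m b) * (1 / ((N : ℝ) + 1)) := by
    intro N
    have hN : (0 : ℝ) < (N : ℝ) + 1 := by positivity
    set p : ℕ → ℝ := fun i => a + (b - a) / (N + 1) * i with hp
    have : 0 ≤ (b - a) / ((N : ℝ) + 1) := div_nonneg (sub_nonneg.2 hab) hN.le
    have hp0 : p 0 = a := by simp [hp]
    have hpN : p (N + 1) = b := by simp only [hp]; push_cast; field_simp; ring
    have hmono : Monotone p := by
      intro i j hij
      simp only [hp]
      gcongr
    have hstep : ∀ i ∈ Finset.range (N + 1),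
        G (p (i + 1)) - G (p i) ≤ (b - a) / (N + 1) * (m (p i) - m (p (i + 1))) := by
      intro i hi
      have hmesh : p (i + 1) - p i = (b - a) / (N + 1) := by simp only [hp]; push_cast; ring
      rw [← hmesh]
      exact h _ _ (hp0 ▸ hmono (Nat.zero_le i)) (hmono (Nat.le_succ i))
        (hpN ▸ hmono (Finset.mem_range.1 hi))
    have hsum := Finset.sum_le_sum hstep
    rw [← Finset.mul_sum, Finset.sum_range_sub (fun i => G (p i)),
      Finset.sum_range_sub' (fun i => m (p i)), hp0, hpN] at hsum
    exact hsum.trans_eq (by ring)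
  have hlim := (tendsto_one_div_add_atTop_nhds_zero_nat (𝕜 := ℝ)).const_mul
    ((b - a) * (m a - m b))
  have := ge_of_tendsto' hlim grid_bound
  linarith

theorem lt_of_ae_deriv_neg {f : ℝ → ℝ} {a b : ℝ} (hab : a < b)
    (hf : AbsolutelyContinuousOnInterval f a b) (hneg : ∀ᵐ t, t ∈ Ioc a b → deriv f t < 0) :
    f b < f a := by
  have hneg' : ∀ᵐ t ∂(volume.restrict (Ioc a b)), 0 < -deriv f t := by
    rw [ae_restrict_iff' measurableSet_Ioc]
    filter_upwards [hneg] with t ht hts using neg_pos.2 (ht hts)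
  have hpos : 0 < ∫ t in Ioc a b, -deriv f t := by
    rw [integral_pos_iff_support_of_nonneg_ae (hneg'.mono fun t ht => ht.le)
      ((intervalIntegrable_iff_integrableOn_Ioc_of_le hab.le).1 hf.intervalIntegrable_deriv).neg,
      measure_of_measure_compl_eq_zero (s := Function.support fun t => -deriv f t)
        (mem_ae_iff.1 (hneg'.mono fun t ht => ht.ne'))]
    simpa using hab
  have hftc := hf.integral_deriv_eq_sub
  rw [intervalIntegral.integral_of_le hab.le] at hftc
  rw [integral_neg, hftc] at hpos
  linarith

theorem exists_last_le {Y β : Type*} [TopologicalSpace Y] [LinearOrder β] {F : Y → β}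
    (hF : LowerSemicontinuous F) {u : ℝ → Y} {a b : ℝ} (hab : a ≤ b)
    (hu : ContinuousOn u (Icc a b)) :
    ∃ s ∈ Icc a b, F (u s) ≤ F (u a) ∧ ∀ t ∈ Ioc s b, F (u a) < F (u t) := by
  have hcomp : IsCompact {r ∈ Icc a b | F (u r) ≤ F (u a)} :=
    isCompact_Icc.of_isClosed_subset
      (hu.preimage_isClosed_of_isClosed isClosed_Icc (hF.isClosed_preimage (F (u a))))
      inter_subset_left
  obtain ⟨s, hs, hmax⟩ := hcomp.exists_isGreatest ⟨a, ⟨le_rfl, hab⟩, le_rfl⟩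
  exact ⟨s, hs.1, hs.2, fun t ht => lt_of_not_ge fun hle =>
    (hmax ⟨⟨hs.1.1.trans ht.1.le, ht.2⟩, hle⟩).not_gt ht.1⟩

theorem abs_sub_le_of_antitoneOn {e w : ℝ → ℝ} {a b t : ℝ} (he : AntitoneOn e (Icc a b))
    (hw : AntitoneOn w (Icc a b)) (ht : t ∈ Icc a b) :
    |w t - e t| ≤ |w a - e b| + |w b - e a| := by
  have ha : a ∈ Icc a b := ⟨le_rfl, ht.1.trans ht.2⟩
  have hb : b ∈ Icc a b := ⟨ht.1.trans ht.2, le_rfl⟩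
  have upper : w t - e t ≤ w a - e b := sub_le_sub (hw ha ht ht.1) (he ht hb ht.2)
  have lower : w b - e a ≤ w t - e t := sub_le_sub (hw ht hb ht.2) (he ha ht ht.1)
  rw [abs_le]
  constructor
  · linarith [neg_abs_le (w b - e a), abs_nonneg (w a - e b)]
  · linarith [le_abs_self (w a - e b), abs_nonneg (w b - e a)]

theorem disjoint_uIoc_of_monotoneOn {v : ℝ → ℝ} {S : Set ℝ} (hv : MonotoneOn v S)
    {p q p' q' : ℝ} (hp : p ∈ S) (hq : q ∈ S) (hp' : p' ∈ S) (hq' : q' ∈ S)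
    (h : Disjoint (uIoc p q) (uIoc p' q')) :
    Disjoint (uIoc (v p) (v q)) (uIoc (v p') (v q')) := by
  wlog hpq : p ≤ q generalizing p q
  · rw [uIoc_comm]
    exact this hq hp (uIoc_comm p q ▸ h) (le_of_not_ge hpq)
  wlog hpq' : p' ≤ q' generalizing p' q'
  · rw [uIoc_comm (v p')]
    exact this hq' hp' (uIoc_comm p' q' ▸ h) (le_of_not_ge hpq')
  rw [uIoc_of_le hpq, uIoc_of_le hpq', Ioc_disjoint_Ioc, min_le_iff, le_max_iff, le_max_iff] at h
  rw [uIoc_of_le (hv hp hq hpq), uIoc_of_le (hv hp' hq' hpq'), Ioc_disjoint_Ioc, min_le_iff,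
    le_max_iff, le_max_iff]
  exact h.imp (Or.imp (hv hq hp) (hv hq hp')) (Or.imp (hv hq' hp) (hv hq' hp'))

theorem sum_dist_le_of_monotoneOn {v : ℝ → ℝ} {a b : ℝ} (hv : MonotoneOn v (Icc a b))
    (hab : a ≤ b) {I : ℕ × (ℕ → ℝ × ℝ)} (hI : I ∈ AbsolutelyContinuousOnInterval.disjWithin a b) :
    ∑ i ∈ Finset.range I.1, dist (v (I.2 i).1) (v (I.2 i).2) ≤ v b - v a := by
  obtain ⟨hmem, hdisj⟩ := hI
  rw [uIcc_of_le hab] at hmem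
  have ha : a ∈ Icc a b := left_mem_Icc.2 hab
  have hb : b ∈ Icc a b := right_mem_Icc.2 hab
  have hvol (i : ℕ) : ENNReal.ofReal (dist (v (I.2 i).1) (v (I.2 i).2)) =
      volume (uIoc (v (I.2 i).1) (v (I.2 i).2)) := by
    rw [uIoc, Real.volume_Ioc, max_sub_min_eq_abs', Real.dist_eq]
  rw [← ENNReal.ofReal_le_ofReal_iff (sub_nonneg.2 (hv ha hb hab)),
    ENNReal.ofReal_sum_of_nonneg (fun _ _ => dist_nonneg), Finset.sum_congr rfl fun i _ => hvol i,
    ← measure_biUnion_finset (fun i hi j hj hij => disjoint_uIoc_of_monotoneOn hv (hmem i hi).1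
      (hmem i hi).2 (hmem j hj).1 (hmem j hj).2 (hdisj hi hj hij)) fun _ _ => measurableSet_uIoc,
    ← Real.volume_Ioc]
  refine measure_mono (iUnion₂_subset fun i hi => Ioc_subset_Ioc (le_min ?_ ?_) (max_le ?_ ?_))
  · exact hv ha (hmem i hi).1 (hmem i hi).1.1
  · exact hv ha (hmem i hi).2 (hmem i hi).2.1
  · exact hv (hmem i hi).1 hb (hmem i hi).1.2
  · exact hv (hmem i hi).2 hb (hmem i hi).2.2

variable {lam : ℝ}

theorem exp_mul_le_exp_abs_mul {b r : ℝ} (hr : 0 ≤ r) (hrb : r ≤ b) :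
    Real.exp (lam * r) ≤ Real.exp (|lam| * b) := by
  apply Real.exp_le_exp.2
  calc lam * r ≤ |lam| * r := by gcongr; exact le_abs_self _
    _ ≤ |lam| * b := by gcongr

theorem abs_exp_mul_sub_exp_mul_le {b s t : ℝ} (hs : 0 ≤ s) (hst : s ≤ t) (htb : t ≤ b) :
    |Real.exp (lam * t) - Real.exp (lam * s)| ≤ |lam| * Real.exp (|lam| * b) * (t - s) := by
  have hderiv (r : ℝ) : HasDerivAt (fun r => Real.exp (lam * r)) (Real.exp (lam * r) * lam) r := by
    simpa using ((hasDerivAt_id r).const_mul lam).exp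
  have hbound : ∀ r ∈ Icc s t, ‖Real.exp (lam * r) * lam‖ ≤ |lam| * Real.exp (|lam| * b) := by
    intro r hr
    rw [norm_mul, Real.norm_eq_abs, Real.norm_eq_abs, Real.abs_exp, mul_comm]
    exact mul_le_mul_of_nonneg_left
      (exp_mul_le_exp_abs_mul (hs.trans hr.1) (hr.2.trans htb)) (abs_nonneg lam)
  have h := (convex_Icc s t).norm_image_sub_le_of_norm_hasDerivWithin_le
    (fun r _ => (hderiv r).hasDerivWithinAt) hbound (left_mem_Icc.2 hst) (right_mem_Icc.2 hst)
  rwa [Real.norm_eq_abs, Real.norm_eq_abs, abs_of_nonneg (sub_nonneg.2 hst)] at h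

theorem intervalIntegrable_exp_mul (s t : ℝ) :
    IntervalIntegrable (fun r => Real.exp (lam * r)) volume s t :=
  Continuous.intervalIntegrable (by fun_prop) s t

theorem integral_exp_mul_nonneg {s t : ℝ} (hst : s ≤ t) : 0 ≤ ∫ r in s..t, Real.exp (lam * r) :=
  intervalIntegral.integral_nonneg hst fun _ _ => (Real.exp_pos _).le

theorem integral_exp_mul_le {b s t : ℝ} (hs : 0 ≤ s) (hst : s ≤ t) (htb : t ≤ b) :
    ∫ r in s..t, Real.exp (lam * r) ≤ Real.exp (|lam| * b) * (t - s) := by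
  calc ∫ r in s..t, Real.exp (lam * r) ≤ ∫ _ in s..t, Real.exp (|lam| * b) :=
        intervalIntegral.integral_mono_on hst (intervalIntegrable_exp_mul s t)
          intervalIntegrable_const
          fun r hr => exp_mul_le_exp_abs_mul (hs.trans hr.1) (hr.2.trans htb)
    _ = Real.exp (|lam| * b) * (t - s) := by
        rw [intervalIntegral.integral_const, smul_eq_mul, mul_comm]

theorem intervalIntegrable_exp_mul_sub {e : ℝ → ℝ} {s t : ℝ} (he : AntitoneOn e (uIcc s t))
    (c : ℝ) : IntervalIntegrable (fun r => Real.exp (lam * r) * (c - e r)) volume s t :=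
  (intervalIntegrable_const.sub he.intervalIntegrable).continuousOn_mul (by fun_prop)

end RealFunctions

section Flow

variable {E : X → EReal} {lam : ℝ} {u : ℝ → X}

theorem IsEVIFlow.absolutelyContinuousOnInterval_exp_mul_dist_sq (h : IsEVIFlow E lam u) (y : X)
    {a b : ℝ} (ha : 0 < a) (hab : a ≤ b) :
    AbsolutelyContinuousOnInterval (fun r => Real.exp (lam * r) / 2 * dist (u r) y ^ 2) a b := by
  have hdist := absolutelyContinuousOnInterval_dist_const (h.locally_ac a b ha hab) y
  have hexp : AbsolutelyContinuousOnInterval (fun r => Real.exp (lam * r) / 2) a b :=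
    ContDiffOn.absolutelyContinuousOnInterval (by fun_prop)
  simpa only [sq, Pi.mul_def] using hexp.mul (hdist.mul hdist)

theorem IsEVIFlow.ae_deriv_le (h : IsEVIFlow E lam u) (hbot : ∀ x, E x ≠ ⊥) {y : X}
    (hy : E y ≠ ⊤) {a b : ℝ} (ha : 0 < a) (hab : a ≤ b) :
    ∀ᵐ t, t ∈ Icc a b → E (u t) ≠ ⊤ ∧
      deriv (fun r => Real.exp (lam * r) / 2 * dist (u r) y ^ 2) t ≤
        Real.exp (lam * t) * ((E y).toReal - (E (u t)).toReal) := by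
  have hdist := absolutelyContinuousOnInterval_dist_const (h.locally_ac a b ha hab) y
  have hsq : AbsolutelyContinuousOnInterval (fun s => dist (u s) y ^ 2) a b := by
    simpa only [sq, Pi.mul_def] using hdist.mul hdist
  filter_upwards [hsq.ae_differentiableAt, (ae_restrict_iff' measurableSet_Ioi).1 (h.evi y)]
    with t hdiff hevi ht
  replace hevi := hevi (ha.trans_le ht.1)
  have htop : E (u t) ≠ ⊤ := by
    intro htop
    rw [htop, EReal.coe_add_top] at hevi
    exact hy (top_le_iff.1 hevi)
  refine ⟨htop, ?_⟩
  have hexp : HasDerivAt (fun r => Real.exp (lam * r) / 2) (Real.exp (lam * t) * lam / 2) t := by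
    simpa using (((hasDerivAt_id t).const_mul lam).exp).div_const 2
  have hprod := (hexp.mul (hdiff (by rwa [uIcc_of_le hab])).hasDerivAt).deriv
  simp only [Pi.mul_def] at hprod
  rw [hprod]
  lift E y to ℝ using ⟨hy, hbot y⟩ with Ey
  lift E (u t) to ℝ using ⟨htop, hbot _⟩ with Eu
  norm_cast at hevi
  simp only [EReal.toReal_coe]
  nlinarith [mul_le_mul_of_nonneg_left hevi (Real.exp_pos (lam * t)).le]

theorem IsEVIFlow.continuousOn (h : IsEVIFlow E lam u) : ContinuousOn u (Ioi 0) := by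
  intro t ht
  have ht : 0 < t := ht
  have hcont := continuousOn_of_absolutelyContinuousOnInterval
    (h.locally_ac (t / 2) (t + 1) (half_pos ht) (by linarith))
  rw [uIcc_of_le (by linarith)] at hcont
  exact (hcont.continuousAt (Icc_mem_nhds (by linarith) (by linarith))).continuousWithinAt

theorem IsEVIFlow.energy_antitone (h : IsEVIFlow E lam u) (hbot : ∀ x, E x ≠ ⊥)
    (hlsc : LowerSemicontinuous E) {a b : ℝ} (ha : 0 < a) (hab : a ≤ b) : E (u b) ≤ E (u a) := by
  by_contra! hcon
  obtain ⟨s, hs, hsa, hlast⟩ := exists_last_le hlsc hab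
    (h.continuousOn.mono fun r hr => ha.trans_le hr.1)
  have hs0 : 0 < s := ha.trans_le hs.1
  have hsb : s < b := hs.2.lt_of_ne (by rintro rfl; exact hsa.not_gt hcon)
  have hys : E (u s) ≠ ⊤ := ne_top_of_le_ne_top hcon.ne_top hsa
  -- The energy exceeds `E (u s)` after time `s`, so the EVI based at `u s` pulls the flow back to
  -- `u s`.
  have hneg : ∀ᵐ t, t ∈ Ioc s b →
      deriv (fun r => Real.exp (lam * r) / 2 * dist (u r) (u s) ^ 2) t < 0 := by
    filter_upwards [h.ae_deriv_le hbot hys hs0 hsb.le] with t ht hts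
    obtain ⟨htop, hle⟩ := ht (Ioc_subset_Icc_self hts)
    have hlt : (E (u s)).toReal < (E (u t)).toReal := by
      rw [← EReal.coe_lt_coe_iff, EReal.coe_toReal hys (hbot _), EReal.coe_toReal htop (hbot _)]
      exact hsa.trans_lt (hlast t hts)
    exact hle.trans_lt (mul_neg_of_pos_of_neg (Real.exp_pos _) (sub_neg.2 hlt))
  have hlt := lt_of_ae_deriv_neg hsb
    (h.absolutelyContinuousOnInterval_exp_mul_dist_sq (u s) hs0 hsb.le) hneg
  rw [dist_self, zero_pow two_ne_zero, mul_zero] at hlt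
  exact hlt.not_ge (by positivity)

theorem IsEVIFlow.energy_ne_top (h : IsEVIFlow E lam u) (hbot : ∀ x, E x ≠ ⊥)
    (hlsc : LowerSemicontinuous E) {y : X} (hy : E y ≠ ⊤) {t : ℝ} (ht : 0 < t) :
    E (u t) ≠ ⊤ := by
  have hae := h.ae_deriv_le hbot hy (half_pos ht) (half_le_self ht.le)
  obtain ⟨r, hr, hfin⟩ : ∃ r ∈ Icc (t / 2) t, E (u r) ≠ ⊤ := by
    by_contra! hcon
    have hnull : volume (Icc (t / 2) t) = 0 :=
      measure_mono_null (fun r hr => mem_ofPred_eq ▸ fun hfin => (hfin hr).1 (hcon r hr))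
        (ae_iff.1 hae)
    rw [Real.volume_Icc, ENNReal.ofReal_eq_zero] at hnull
    linarith
  exact ne_top_of_le_ne_top hfin (h.energy_antitone hbot hlsc ((half_pos ht).trans_le hr.1) hr.2)

end Flow

/-- The integrated form of the evolution variational inequality, along a curve of finite and
nonincreasing energy. Every estimate on an `EVI_λ`-gradient flow below is derived from it. -/
structure IntegratedEVI (E : X → EReal) (lam : ℝ) (u : ℝ → X) : Prop where
  continuousOn : ContinuousOn u (Ioi 0)
  energy_ne_top : ∀ t, 0 < t → E (u t) ≠ ⊤
  antitoneOn : AntitoneOn (fun t => (E (u t)).toReal) (Ioi 0)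
  evi : ∀ s t y, 0 < s → s ≤ t → E y ≠ ⊤ →
    Real.exp (lam * t) / 2 * dist (u t) y ^ 2 - Real.exp (lam * s) / 2 * dist (u s) y ^ 2 ≤
      ∫ r in s..t, Real.exp (lam * r) * ((E y).toReal - (E (u r)).toReal)

section Integrated

variable {E : X → EReal} {lam : ℝ} {u w : ℝ → X}

theorem uIcc_subset_Ioi_zero {s t : ℝ} (hs : 0 < s) (hst : s ≤ t) : uIcc s t ⊆ Ioi 0 := by
  rw [uIcc_of_le hst]
  exact fun r hr => hs.trans_le hr.1

theorem IsEVIFlow.integratedEVI (h : IsEVIFlow E lam u) (hbot : ∀ x, E x ≠ ⊥)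
    (hlsc : LowerSemicontinuous E) (hdom : ∃ z, E z ≠ ⊤) : IntegratedEVI E lam u := by
  obtain ⟨z, hz⟩ := hdom
  have hfin : ∀ t, 0 < t → E (u t) ≠ ⊤ := fun t ht => h.energy_ne_top hbot hlsc hz ht
  have hanti : AntitoneOn (fun t => (E (u t)).toReal) (Ioi 0) := fun s hs t _ hst =>
    EReal.toReal_le_toReal (h.energy_antitone hbot hlsc hs hst) (hbot _) (hfin s hs)
  refine ⟨h.continuousOn, hfin, hanti, fun s t y hs hst hy => ?_⟩
  have hac := h.absolutelyContinuousOnInterval_exp_mul_dist_sq y hs hst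
  rw [← hac.integral_deriv_eq_sub]
  refine intervalIntegral.integral_mono_ae_restrict hst hac.intervalIntegrable_deriv
    (intervalIntegrable_exp_mul_sub (hanti.mono (uIcc_subset_Ioi_zero hs hst)) _) ?_
  rw [EventuallyLE, ae_restrict_iff' measurableSet_Icc]
  filter_upwards [h.ae_deriv_le hbot hy hs hst] with r hr hrs using (hr hrs).2

theorem IntegratedEVI.shift (h : IntegratedEVI E lam u) {τ : ℝ} (hτ : 0 ≤ τ) :
    IntegratedEVI E lam (fun t => u (t + τ)) where
  continuousOn := h.continuousOn.comp (by fun_prop) fun _ ht => add_pos_of_pos_of_nonneg ht hτ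
  energy_ne_top t ht := h.energy_ne_top _ (add_pos_of_pos_of_nonneg ht hτ)
  antitoneOn _ hs _ ht hst := h.antitoneOn (add_pos_of_pos_of_nonneg hs hτ)
    (add_pos_of_pos_of_nonneg ht hτ) (by linarith)
  evi s t y hs hst hy := by
    have hevi := h.evi (s + τ) (t + τ) y (by linarith) (by linarith) hy
    rw [← intervalIntegral.integral_comp_add_right] at hevi
    have hexp (r : ℝ) : Real.exp (lam * (r + τ)) = Real.exp (lam * τ) * Real.exp (lam * r) := by
      rw [← Real.exp_add]; ring_nf
    simp only [hexp, mul_assoc, intervalIntegral.integral_const_mul] at hevi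
    refine le_of_mul_le_mul_left ?_ (Real.exp_pos (lam * τ))
    linarith

theorem IntegratedEVI.evi_endpoint (h : IntegratedEVI E lam u) {s t : ℝ} {y : X} (hs : 0 < s)
    (hst : s ≤ t) (hy : E y ≠ ⊤) :
    Real.exp (lam * t) / 2 * dist (u t) y ^ 2 - Real.exp (lam * s) / 2 * dist (u s) y ^ 2 ≤
      (∫ r in s..t, Real.exp (lam * r)) * ((E y).toReal - (E (u t)).toReal) := by
  refine (h.evi s t y hs hst hy).trans ?_
  rw [← intervalIntegral.integral_mul_const]
  refine intervalIntegral.integral_mono_on hst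
    (intervalIntegrable_exp_mul_sub (h.antitoneOn.mono (uIcc_subset_Ioi_zero hs hst)) _)
    ((intervalIntegrable_exp_mul s t).mul_const _) fun r hr => ?_
  have hanti : (E (u t)).toReal ≤ (E (u r)).toReal :=
    h.antitoneOn (hs.trans_le hr.1) (hs.trans_le hst) hr.2
  gcongr

/-! ### Contraction -/

/-- The EVI of `u` is tested with `w t`, that of `w` with `u s`. -/
theorem IntegratedEVI.exp_sq_mul_dist_sq_sub_le (hu : IntegratedEVI E lam u)
    (hw : IntegratedEVI E lam w) {s t : ℝ} (hs : 0 < s) (hst : s ≤ t) :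
    Real.exp (lam * t) ^ 2 / 2 * dist (u t) (w t) ^ 2 -
        Real.exp (lam * s) ^ 2 / 2 * dist (u s) (w s) ^ 2 ≤
      (∫ r in s..t, Real.exp (lam * r)) *
        (Real.exp (lam * s) * ((E (u s)).toReal - (E (u t)).toReal) +
          (Real.exp (lam * t) - Real.exp (lam * s)) *
            ((E (w t)).toReal - (E (u t)).toReal)) := by
  have hut := hu.evi_endpoint hs hst (hw.energy_ne_top t (hs.trans_le hst))
  have hwt := hw.evi_endpoint hs hst (hu.energy_ne_top s hs)
  rw [dist_comm (w t), dist_comm (w s)] at hwt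
  linarith [mul_le_mul_of_nonneg_left hut (Real.exp_pos (lam * t)).le,
    mul_le_mul_of_nonneg_left hwt (Real.exp_pos (lam * s)).le]

theorem IntegratedEVI.contraction (hu : IntegratedEVI E lam u) (hw : IntegratedEVI E lam w)
    {a b : ℝ} (ha : 0 < a) (hab : a ≤ b) :
    Real.exp (lam * b) * dist (u b) (w b) ≤ Real.exp (lam * a) * dist (u a) (w a) := by
  set eu : ℝ → ℝ := fun t => (E (u t)).toReal
  set ew : ℝ → ℝ := fun t => (E (w t)).toReal
  set C := Real.exp (|lam| * b)
  set M := |ew a - eu b| + |ew b - eu a|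
  suffices hG : Real.exp (lam * b) ^ 2 / 2 * dist (u b) (w b) ^ 2 ≤
      Real.exp (lam * a) ^ 2 / 2 * dist (u a) (w a) ^ 2 by
    refine le_of_sq_le_sq ?_ (by positivity)
    linarith
  refine le_of_increment_le_mul (G := fun t => Real.exp (lam * t) ^ 2 / 2 * dist (u t) (w t) ^ 2)
    (m := fun t => C ^ 2 * eu t - C ^ 2 * |lam| * M * t) hab fun s t has hst htb => ?_
  have hs : 0 < s := ha.trans_le has
  have ht : 0 < t := hs.trans_le hst
  have hsub : Icc a b ⊆ Ioi 0 := fun r hr => ha.trans_le hr.1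
  have hdecay : 0 ≤ eu s - eu t := sub_nonneg.2 (hu.antitoneOn hs ht hst)
  have hgap : |ew t - eu t| ≤ M := abs_sub_le_of_antitoneOn (hu.antitoneOn.mono hsub)
    (hw.antitoneOn.mono hsub) ⟨has.trans hst, htb⟩
  have hexp := abs_exp_mul_sub_exp_mul_le (lam := lam) hs.le hst htb
  have hbracket : Real.exp (lam * s) * (eu s - eu t) +
      (Real.exp (lam * t) - Real.exp (lam * s)) * (ew t - eu t) ≤
      C * (eu s - eu t) + |lam| * C * (t - s) * M := by
    refine add_le_add ?_ ((le_abs_self _).trans ?_)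
    · gcongr
      exact exp_mul_le_exp_abs_mul hs.le (hst.trans htb)
    · rw [abs_mul]
      exact mul_le_mul hexp hgap (abs_nonneg _) ((abs_nonneg _).trans hexp)
  have : 0 ≤ t - s := sub_nonneg.2 hst
  calc _ ≤ (∫ r in s..t, Real.exp (lam * r)) * (C * (eu s - eu t) + |lam| * C * (t - s) * M) :=
        (hu.exp_sq_mul_dist_sq_sub_le hw hs hst).trans
          (mul_le_mul_of_nonneg_left hbracket (integral_exp_mul_nonneg hst))
    _ ≤ C * (t - s) * (C * (eu s - eu t) + |lam| * C * (t - s) * M) :=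
        mul_le_mul_of_nonneg_right (integral_exp_mul_le hs.le hst htb) (by positivity)
    _ = _ := by ring

end Integrated

/-- The descent of `E` from `x` is at most linear with rate `c`, up to the quadratic correction
of a `lam`-convex function. -/
def SlopeBound (E : X → EReal) (lam c : ℝ) (x : X) : Prop :=
  ∀ y, E x ≤ E y + ((c * dist x y - lam / 2 * dist x y ^ 2 : ℝ) : EReal)

/-- The global slope: the smallest rate in `SlopeBound`. It dominates `slope` and, unlike `slope`,
is lower semicontinuous whenever `E` is. -/
noncomputable def globalSlope (E : X → EReal) (lam : ℝ) (x : X) : ℝ≥0∞ :=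
  ⨅ (c : NNReal) (_ : SlopeBound E lam c x), (c : ℝ≥0∞)

section Slope

variable {E : X → EReal} {lam : ℝ} {x : X}

theorem SlopeBound.mono {c c' : ℝ} (h : SlopeBound E lam c x) (hc : c ≤ c') :
    SlopeBound E lam c' x := fun y =>
  (h y).trans (add_le_add le_rfl (EReal.coe_le_coe_iff.2 (by gcongr)))

theorem SlopeBound.globalSlope_le {c : ℝ} (h : SlopeBound E lam c x) (hc : 0 ≤ c) :
    globalSlope E lam x ≤ ENNReal.ofReal c :=
  iInf₂_le c.toNNReal (by rwa [Real.coe_toNNReal c hc])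

theorem slopeBound_of_globalSlope_lt {c : NNReal} (h : globalSlope E lam x < c) :
    SlopeBound E lam c x := by
  simp only [globalSlope, iInf_lt_iff] at h
  obtain ⟨c', hb, hlt⟩ := h
  exact hb.mono (by exact_mod_cast hlt.le)

theorem isClosed_slopeBound (hlsc : LowerSemicontinuous E) (hbot : ∀ x, E x ≠ ⊥) (c : ℝ) :
    IsClosed {x | SlopeBound E lam c x} := by
  simp only [SlopeBound, ofPred_forall]
  refine isClosed_iInter fun y => ?_
  have hcont : Continuous fun x : X =>
      E y + ((c * dist x y - lam / 2 * dist x y ^ 2 : ℝ) : EReal) := by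
    have hreal : Continuous fun x : X =>
        ((c * dist x y - lam / 2 * dist x y ^ 2 : ℝ) : EReal) :=
      continuous_coe_real_ereal.comp (by fun_prop)
    rw [continuous_iff_continuousAt]
    exact fun x => ContinuousAt.comp (f := fun x : X => (E y, _))
      (g := fun p : EReal × EReal => p.1 + p.2)
      (EReal.continuousAt_add (Or.inr (EReal.coe_ne_bot _)) (Or.inl (hbot y)))
      (continuousAt_const.prodMk hreal.continuousAt)
  exact hlsc.isClosed_epigraph.preimage (continuous_id.prodMk hcont)

theorem globalSlope_preimage_Iic (c : NNReal) :
    globalSlope E lam ⁻¹' Iic (c : ℝ≥0∞) =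
      ⋂ (c' : NNReal) (_ : c < c'), {x | SlopeBound E lam c' x} := by
  ext x
  simp only [mem_preimage, mem_Iic, mem_iInter]
  constructor
  · exact fun h c' hc => slopeBound_of_globalSlope_lt (h.trans_lt (by exact_mod_cast hc))
  · intro h
    refine ENNReal.le_of_forall_pos_le_add fun ε hε _ => ?_
    have := SlopeBound.globalSlope_le (h (c + ε) (by simpa using hε)) (NNReal.coe_nonneg _)
    rwa [ENNReal.ofReal_coe_nnreal, ENNReal.coe_add] at this

theorem lowerSemicontinuous_globalSlope (hlsc : LowerSemicontinuous E) (hbot : ∀ x, E x ≠ ⊥) :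
    LowerSemicontinuous (globalSlope E lam) := by
  rw [lowerSemicontinuous_iff_isClosed_preimage]
  intro c
  induction c with
  | top => simp
  | coe c =>
    rw [globalSlope_preimage_Iic]
    exact isClosed_biInter fun c' _ => isClosed_slopeBound hlsc hbot c'

theorem SlopeBound.ne_top {c : ℝ} (h : SlopeBound E lam c x) {y : X} (hy : E y ≠ ⊤) : E x ≠ ⊤ :=
  ne_top_of_le_ne_top (EReal.add_lt_top hy (EReal.coe_ne_top _)).ne (h y)

theorem SlopeBound.descent_div_le {c : NNReal} (h : SlopeBound E lam c x) (hbot : ∀ x, E x ≠ ⊥)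
    (hx : E x ≠ ⊤) {y : X} (hxy : x ≠ y) :
    (E x - E y).toENNReal / edist x y ≤ ENNReal.ofReal (c + |lam| / 2 * dist x y) := by
  rw [ENNReal.div_le_iff (edist_pos.2 hxy).ne' (edist_ne_top _ _), edist_dist,
    ← ENNReal.ofReal_mul (by positivity)]
  have hsub : E x - E y ≤ (((c + |lam| / 2 * dist x y) * dist x y : ℝ) : EReal) := by
    by_cases hy : E y = ⊤
    · rw [hy, EReal.sub_top]
      exact bot_le
    have hxy := h y
    lift E y to ℝ using ⟨hy, hbot y⟩ with Ey
    lift E x to ℝ using ⟨hx, hbot x⟩ with Ex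
    norm_cast at hxy ⊢
    nlinarith [neg_abs_le lam, sq_nonneg (dist x y)]
  refine (EReal.toENNReal_le_toENNReal hsub).trans_eq ?_
  rw [EReal.toENNReal_of_ne_top (EReal.coe_ne_top _), EReal.toReal_coe]

theorem SlopeBound.slope_le {c : NNReal} (h : SlopeBound E lam c x) (hbot : ∀ x, E x ≠ ⊥)
    (hx : E x ≠ ⊤) : slope E x ≤ c := by
  rw [slope, if_neg hx]
  obtain hisol | hacc := (𝓝[≠] x).eq_or_neBot
  · rw [hisol, limsup_bot]
    exact bot_le
  have hcont : Continuous fun y => ENNReal.ofReal (c + |lam| / 2 * dist x y) :=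
    ENNReal.continuous_ofReal.comp (by fun_prop)
  have hlim : Tendsto (fun y => ENNReal.ofReal (c + |lam| / 2 * dist x y)) (𝓝[≠] x)
      (𝓝 (c : ℝ≥0∞)) := by
    simpa using (hcont.tendsto x).mono_left nhdsWithin_le_nhds
  rw [← hlim.limsup_eq]
  refine limsup_le_limsup ?_
  filter_upwards [self_mem_nhdsWithin] with y hy using h.descent_div_le hbot hx (Ne.symm hy)

theorem slope_le_globalSlope (hbot : ∀ x, E x ≠ ⊥) (hdom : ∃ z, E z ≠ ⊤) (x : X) :
    slope E x ≤ globalSlope E lam x :=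
  le_iInf₂ fun _ hc => hc.slope_le hbot (hc.ne_top hdom.choose_spec)

end Slope

section Calculus

theorem hasDerivAt_nonpos_of_frequently_le {N : ℝ → ℝ} {n : ℝ} (h : HasDerivAt N n 0)
    (hf : ∃ᶠ τ in 𝓝[>] 0, N τ ≤ N 0) : n ≤ 0 := by
  by_contra! hn
  have hslope := (hasDerivAt_iff_tendsto_slope.1 h).mono_left
    (nhdsWithin_mono 0 fun τ (hτ : 0 < τ) => hτ.ne')
  refine hf ?_
  filter_upwards [hslope.eventually (lt_mem_nhds hn), self_mem_nhdsWithin] with τ hτ hpos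
  rw [slope_def_field, sub_zero, div_pos_iff_of_pos_right hpos] at hτ
  linarith

theorem eventually_sub_le_mul_of_hasDerivAt {e : ℝ → ℝ} {d p s : ℝ} (hd : HasDerivAt e d s)
    (hp : -d < p) : ∀ᶠ r in 𝓝[>] s, e s - e r ≤ p * (r - s) := by
  have hslope := (hasDerivAt_iff_tendsto_slope.1 hd).mono_left
    (nhdsWithin_mono s fun r (hr : s < r) => hr.ne')
  filter_upwards [hslope.eventually (lt_mem_nhds (by linarith : -p < d)), self_mem_nhdsWithin]
    with r hr hsr
  rw [slope_def_field, lt_div_iff₀ (sub_pos.2 hsr)] at hr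
  linarith

theorem mul_le_mul_add_abs_mul (lam : ℝ) {r t τ : ℝ} (h : |r - t| ≤ τ) :
    lam * r ≤ lam * t + |lam| * τ := by
  have : lam * (r - t) ≤ |lam| * τ :=
    (le_abs_self _).trans (abs_mul lam (r - t) ▸ mul_le_mul_of_nonneg_left h (abs_nonneg lam))
  linarith

/-- The derivative at the initial time of the two sides of `IntegratedEVI.evi_endpoint`, when the
energy is replaced by a constant and the distance to `y` decreases at rate `c` from `D`. -/
theorem hasDerivAt_integral_exp_mul_add (lam s z c D : ℝ) :
    HasDerivAt (fun τ => (∫ r in s..(s + τ), Real.exp (lam * r)) * z +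
        Real.exp (lam * (s + τ)) / 2 * (D - c * τ) ^ 2)
      (Real.exp (lam * s) * (z + lam / 2 * D ^ 2 - c * D)) 0 := by
  have hintegral : HasDerivAt (fun τ => ∫ r in s..(s + τ), Real.exp (lam * r))
      (Real.exp (lam * s)) 0 := by
    have hexp : Continuous fun r => Real.exp (lam * r) := by fun_prop
    have hderiv := (hexp.integral_hasStrictDerivAt s s).hasDerivAt
    rw [← add_zero s] at hderiv
    simpa using HasDerivAt.comp_const_add s 0 (by simpa using hderiv)
  have hexp : HasDerivAt (fun τ => Real.exp (lam * (s + τ)) / 2) (Real.exp (lam * s) * lam / 2)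
      0 := by
    simpa using ((((hasDerivAt_id (0 : ℝ)).const_add s).const_mul lam).exp).div_const 2
  have hsq : HasDerivAt (fun τ => (D - c * τ) ^ 2) (2 * D * (-c)) 0 := by
    simpa using (((hasDerivAt_id (0 : ℝ)).const_mul c).const_sub D).fun_pow 2
  refine ((hintegral.mul_const z).fun_add (hexp.fun_mul hsq)).congr_deriv ?_
  simp only [add_zero, mul_zero, sub_zero]
  ring

end Calculus

/-! ### Dissipation controls the global slope -/

section Integrated

variable {E : X → EReal} {lam : ℝ} {u : ℝ → X}

theorem IntegratedEVI.le_of_dist_le (h : IntegratedEVI E lam u) {s τ c z : ℝ} {y : X} (hs : 0 < s)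
    (hτ : 0 ≤ τ) (hy : E y ≠ ⊤) (hdist : dist (u (s + τ)) (u s) ≤ c * τ)
    (hcτ : c * τ ≤ dist (u s) y) (hz : z ≤ (E (u (s + τ))).toReal) :
    (∫ r in s..(s + τ), Real.exp (lam * r)) * (z - (E y).toReal) +
        Real.exp (lam * (s + τ)) / 2 * (dist (u s) y - c * τ) ^ 2 ≤
      Real.exp (lam * s) / 2 * dist (u s) y ^ 2 := by
  have hsτ : s ≤ s + τ := le_add_of_nonneg_right hτ
  have hevi := h.evi_endpoint hs hsτ hy
  have htri : dist (u s) y - c * τ ≤ dist (u (s + τ)) y := by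
    linarith [dist_triangle_left (u s) y (u (s + τ))]
  have hkinetic : Real.exp (lam * (s + τ)) / 2 * (dist (u s) y - c * τ) ^ 2 ≤
      Real.exp (lam * (s + τ)) / 2 * dist (u (s + τ)) y ^ 2 := by
    have := sub_nonneg.2 hcτ
    gcongr
  have henergy := mul_le_mul_of_nonneg_left (sub_le_sub_right hz (E y).toReal)
    (integral_exp_mul_nonneg (lam := lam) hsτ)
  linarith

theorem IntegratedEVI.tendsto_nhdsGT (h : IntegratedEVI E lam u) {s : ℝ} (hs : 0 < s) :
    Tendsto (fun τ => u (s + τ)) (𝓝[>] 0) (𝓝 (u s)) := by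
  have hadd : Continuous fun τ : ℝ => s + τ := by fun_prop
  refine (h.continuousOn.continuousAt (Ioi_mem_nhds hs)).tendsto.comp ?_
  simpa using (hadd.tendsto 0).mono_left nhdsWithin_le_nhds

/-- The metric speed of the flow bounds the global slope: differentiate `le_of_dist_le` in `τ`. -/
theorem IntegratedEVI.slopeBound_of_frequently (h : IntegratedEVI E lam u)
    (hbot : ∀ x, E x ≠ ⊥) (hlsc : LowerSemicontinuous E) {s c : ℝ} (hs : 0 < s)
    (hf : ∃ᶠ τ in 𝓝[>] 0, dist (u (s + τ)) (u s) ≤ c * τ) : SlopeBound E lam c (u s) := by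
  intro y
  by_cases hy : E y = ⊤
  · rw [hy, EReal.top_add_coe]
    exact le_top
  obtain hus | hus := eq_or_ne (u s) y
  · simp [hus]
  have hD : 0 < dist (u s) y := dist_pos.2 hus
  have hfin := h.energy_ne_top s hs
  rw [← EReal.coe_toReal hfin (hbot _), ← EReal.coe_toReal hy (hbot _), ← EReal.coe_add,
    EReal.coe_le_coe_iff]
  refine le_of_forall_lt_imp_le_of_dense fun z hz => ?_
  have henergy : ∀ᶠ τ in 𝓝[>] (0 : ℝ), (z : EReal) < E (u (s + τ)) := by
    refine (h.tendsto_nhdsGT hs).eventually (hlsc (u s) z ?_)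
    change (z : EReal) < E (u s)
    rwa [← EReal.coe_toReal hfin (hbot _), EReal.coe_lt_coe_iff]
  have hclose : ∀ᶠ τ in 𝓝[>] (0 : ℝ), c * τ < dist (u s) y := by
    have hmul : Continuous fun τ : ℝ => c * τ := by fun_prop
    exact ((hmul.tendsto 0).mono_left nhdsWithin_le_nhds).eventually
      (gt_mem_nhds (by simpa using hD))
  have hderiv := hasDerivAt_nonpos_of_frequently_le
    (hasDerivAt_integral_exp_mul_add lam s (z - (E y).toReal) c (dist (u s) y)) <| by
      refine (hf.and_eventually ((henergy.and hclose).and self_mem_nhdsWithin)).mono ?_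
      rintro τ ⟨hdist, ⟨hzτ, hcτ⟩, hτ⟩
      have hτ : 0 < τ := hτ
      have hz' : z ≤ (E (u (s + τ))).toReal :=
        EReal.coe_le_coe_iff.1 (by
          rw [EReal.coe_toReal (h.energy_ne_top (s + τ) (by linarith)) (hbot _)]
          exact hzτ.le)
      simpa using h.le_of_dist_le hs hτ.le hy hdist hcτ.le hz'
  linarith [nonpos_of_mul_nonpos_right hderiv (Real.exp_pos (lam * s))]

theorem IntegratedEVI.dist_sq_le_of_energy_drop_le (h : IntegratedEVI E lam u) {s t p : ℝ}
    (hs : 0 < s) (hst : s ≤ t)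
    (hdrop : ∀ r ∈ Ioc s t, (E (u s)).toReal - (E (u r)).toReal ≤ p * (r - s)) :
    dist (u t) (u s) ^ 2 ≤ Real.exp (|lam| * (t - s)) * p * (t - s) ^ 2 := by
  have hint : ∫ r in s..t, Real.exp (lam * r) * ((E (u s)).toReal - (E (u r)).toReal) ≤
      ∫ r in s..t, Real.exp (lam * t + |lam| * (t - s)) * (p * (r - s)) := by
    refine intervalIntegral.integral_mono_on hst
      (intervalIntegrable_exp_mul_sub (h.antitoneOn.mono (uIcc_subset_Ioi_zero hs hst)) _)
      (Continuous.intervalIntegrable (by fun_prop) _ _) fun r hr => ?_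
    obtain rfl | hlt := hr.1.eq_or_lt
    · simp
    have hexp : lam * r ≤ lam * t + |lam| * (t - s) :=
      mul_le_mul_add_abs_mul lam (abs_le.2 ⟨by linarith, by linarith [hr.2]⟩)
    have hdrop0 : 0 ≤ (E (u s)).toReal - (E (u r)).toReal :=
      sub_nonneg.2 (h.antitoneOn hs (hs.trans hlt) hr.1)
    exact mul_le_mul (Real.exp_le_exp.2 hexp) (hdrop r ⟨hlt, hr.2⟩) hdrop0 (Real.exp_pos _).le
  have hval : ∫ r in s..t, Real.exp (lam * t + |lam| * (t - s)) * (p * (r - s)) =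
      Real.exp (lam * t) / 2 * (Real.exp (|lam| * (t - s)) * p * (t - s) ^ 2) := by
    rw [intervalIntegral.integral_const_mul, intervalIntegral.integral_const_mul,
      intervalIntegral.integral_comp_sub_right (fun r => r), integral_id, Real.exp_add]
    ring
  have hevi := h.evi s t (u s) hs hst (h.energy_ne_top s hs)
  rw [dist_self, zero_pow two_ne_zero, mul_zero, sub_zero] at hevi
  exact le_of_mul_le_mul_left (hevi.trans (hint.trans_eq hval)) (half_pos (Real.exp_pos _))

theorem IntegratedEVI.eventually_dist_le (h : IntegratedEVI E lam u) {s c d : ℝ} (hs : 0 < s)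
    (hc : 0 < c) (hd : HasDerivAt (fun t => (E (u t)).toReal) d s) (hcd : -d < c ^ 2) :
    ∀ᶠ τ in 𝓝[>] 0, dist (u (s + τ)) (u s) ≤ c * τ := by
  obtain ⟨p, hdp, hpc⟩ := exists_between hcd
  obtain ⟨δ, hδ, hdrop⟩ := mem_nhdsGT_iff_exists_Ioo_subset.1
    (eventually_sub_le_mul_of_hasDerivAt hd hdp)
  have hexp : ∀ᶠ τ in 𝓝[>] (0 : ℝ), Real.exp (|lam| * τ) * p < c ^ 2 := by
    have hcont : Continuous fun τ : ℝ => Real.exp (|lam| * τ) * p := by fun_prop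
    exact ((hcont.tendsto 0).mono_left nhdsWithin_le_nhds).eventually
      (gt_mem_nhds (by simpa using hpc))
  have hsmall : ∀ᶠ τ in 𝓝[>] (0 : ℝ), τ < δ - s :=
    nhdsWithin_le_nhds (gt_mem_nhds (sub_pos.2 hδ))
  filter_upwards [hexp, hsmall, self_mem_nhdsWithin] with τ hexp hsmall hτ
  have hτ : 0 < τ := hτ
  have hsq := h.dist_sq_le_of_energy_drop_le hs (le_add_of_nonneg_right hτ.le)
    fun r hr => hdrop ⟨hr.1, by linarith [hr.2]⟩
  rw [add_sub_cancel_left] at hsq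
  refine le_of_sq_le_sq (hsq.trans ?_) (by positivity)
  rw [mul_pow]
  gcongr

theorem IntegratedEVI.globalSlope_le_of_hasDerivAt (h : IntegratedEVI E lam u)
    (hbot : ∀ x, E x ≠ ⊥) (hlsc : LowerSemicontinuous E) {s t d : ℝ} (hs : 0 < s) (hst : s ≤ t)
    (hd : HasDerivAt (fun t => (E (u t)).toReal) d s) :
    globalSlope E lam (u t) ≤ ENNReal.ofReal (Real.exp (lam * s - lam * t) * √(-d)) := by
  have hbound : ∀ c, √(-d) < c →
      globalSlope E lam (u t) ≤ ENNReal.ofReal (Real.exp (lam * s - lam * t) * c) := by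
    intro c hc
    have hc0 : 0 < c := (Real.sqrt_nonneg _).trans_lt hc
    refine SlopeBound.globalSlope_le ?_ (by positivity)
    refine h.slopeBound_of_frequently hbot hlsc (hs.trans_le hst) (Eventually.frequently ?_)
    filter_upwards [h.eventually_dist_le hs hc0 hd ((Real.sqrt_lt' hc0).1 hc),
      self_mem_nhdsWithin] with τ hτ hτ0
    -- The speed at time `t` is compared with the speed at time `s` by contraction.
    have hcon := (h.shift (le_of_lt hτ0)).contraction h hs hst
    rw [Real.exp_sub, div_mul_eq_mul_div, div_mul_eq_mul_div, le_div_iff₀ (Real.exp_pos _)]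
    linarith [mul_le_mul_of_nonneg_left hτ (Real.exp_pos (lam * s)).le]
  have hcont : Continuous fun c => ENNReal.ofReal (Real.exp (lam * s - lam * t) * c) :=
    ENNReal.continuous_ofReal.comp (by fun_prop)
  exact ge_of_tendsto ((hcont.tendsto _).mono_left nhdsWithin_le_nhds)
    (eventually_nhdsWithin_of_forall (s := Ioi √(-d)) hbound)

theorem IntegratedEVI.ae_globalSlope_le (h : IntegratedEVI E lam u) (hbot : ∀ x, E x ≠ ⊥)
    (hlsc : LowerSemicontinuous E) : ∀ᵐ s, 0 < s → ∀ t, s ≤ t → globalSlope E lam (u t) ≤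
      ENNReal.ofReal (Real.exp (lam * s - lam * t) *
        √(deriv (fun r => -(E (u r)).toReal) s)) := by
  filter_upwards [h.antitoneOn.neg.ae_differentiableWithinAt_of_mem] with s hdiff hs t hst
  have hderiv := ((hdiff hs).differentiableAt (Ioi_mem_nhds hs)).hasDerivAt.fun_neg
  simp only [neg_neg] at hderiv
  have hle := h.globalSlope_le_of_hasDerivAt hbot hlsc hs hst hderiv
  rwa [neg_neg] at hle

theorem IntegratedEVI.globalSlope_ne_top (h : IntegratedEVI E lam u) (hbot : ∀ x, E x ≠ ⊥)
    (hlsc : LowerSemicontinuous E) {t : ℝ} (ht : 0 < t) : globalSlope E lam (u t) ≠ ⊤ := by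
  intro htop
  have hnull : volume (Ioc 0 t) = 0 := by
    refine measure_mono_null (fun s hs => ?_) (ae_iff.1 (h.ae_globalSlope_le hbot hlsc))
    exact mem_ofPred_eq ▸ fun hle =>
      ne_top_of_le_ne_top ENNReal.ofReal_ne_top (hle hs.1 t hs.2) htop
  rw [Real.volume_Ioc, ENNReal.ofReal_eq_zero] at hnull
  linarith

theorem IntegratedEVI.globalSlope_sq_mul_le (h : IntegratedEVI E lam u) (hbot : ∀ x, E x ≠ ⊥)
    (hlsc : LowerSemicontinuous E) {s t : ℝ} (hs : 0 < s) (hst : s ≤ t) :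
    (globalSlope E lam (u t)).toReal ^ 2 * Real.exp (-(2 * |lam| * (t - s))) * (t - s) ≤
      (E (u s)).toReal - (E (u t)).toReal := by
  set ℓ := (globalSlope E lam (u t)).toReal
  have hmono : MonotoneOn (fun r => -(E (u r)).toReal) (Ioi 0) := h.antitoneOn.neg
  have hmono' := hmono.mono (uIcc_subset_Ioi_zero hs hst)
  have hdissipation : ∫ r in s..t, deriv (fun r => -(E (u r)).toReal) r ≤
      -(E (u t)).toReal - -(E (u s)).toReal := by
    have hmem := hmono'.intervalIntegral_deriv_mem_uIcc
    rw [uIcc_of_le (sub_nonneg.2 (hmono hs (hs.trans_le hst) hst))] at hmem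
    exact hmem.2
  have hint : ∫ _ in s..t, ℓ ^ 2 * Real.exp (-(2 * |lam| * (t - s))) ≤
      ∫ r in s..t, deriv (fun r => -(E (u r)).toReal) r := by
    refine intervalIntegral.integral_mono_ae_restrict hst intervalIntegrable_const
      hmono'.intervalIntegrable_deriv ?_
    rw [EventuallyLE, ae_restrict_iff' measurableSet_Icc]
    filter_upwards [h.ae_globalSlope_le hbot hlsc] with r hle hr
    have hr0 : 0 < r := hs.trans_le hr.1
    have hderiv : 0 ≤ deriv (fun r => -(E (u r)).toReal) r := by
      rw [← derivWithin_of_mem_nhds (Ioi_mem_nhds hr0)]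
      exact hmono.derivWithin_nonneg
    have hℓ : ℓ ≤ Real.exp (lam * r - lam * t) * √(deriv (fun r => -(E (u r)).toReal) r) :=
      ENNReal.toReal_le_of_le_ofReal (by positivity) (hle hr0 t hr.2)
    have hexp : lam * r ≤ lam * t + |lam| * (t - s) :=
      mul_le_mul_add_abs_mul lam (abs_le.2 ⟨by linarith [hr.1], by linarith [hr.2]⟩)
    calc ℓ ^ 2 * Real.exp (-(2 * |lam| * (t - s)))
        ≤ (Real.exp (lam * r - lam * t) * √(deriv (fun r => -(E (u r)).toReal) r)) ^ 2 *
            Real.exp (-(2 * (lam * r - lam * t))) :=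
          mul_le_mul (pow_le_pow_left₀ ENNReal.toReal_nonneg hℓ 2)
            (Real.exp_le_exp.2 (by linarith)) (Real.exp_pos _).le (sq_nonneg _)
      _ = deriv (fun r => -(E (u r)).toReal) r := by
          rw [mul_pow, Real.sq_sqrt hderiv, mul_right_comm, ← Real.exp_nat_mul, ← Real.exp_add]
          simp
  rw [intervalIntegral.integral_const, smul_eq_mul] at hint
  linarith

/-- The estimate of `IntegratedEVI.evi_endpoint`, improved by keeping the energy dissipated between
`r` and `t` under the integral. -/
theorem IntegratedEVI.evi_globalSlope (h : IntegratedEVI E lam u) (hbot : ∀ x, E x ≠ ⊥)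
    (hlsc : LowerSemicontinuous E) {s t : ℝ} {y : X} (hs : 0 < s) (hst : s ≤ t) (hy : E y ≠ ⊤) :
    Real.exp (lam * t) / 2 * dist (u t) y ^ 2 - Real.exp (lam * s) / 2 * dist (u s) y ^ 2 ≤
      (∫ r in s..t, Real.exp (lam * r)) * ((E y).toReal - (E (u t)).toReal) -
      Real.exp (lam * s - 3 * |lam| * (t - s)) *
        (globalSlope E lam (u t)).toReal ^ 2 * ((t - s) ^ 2 / 2) := by
  set ℓ := (globalSlope E lam (u t)).toReal
  set K := Real.exp (lam * s - 3 * |lam| * (t - s)) * ℓ ^ 2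
  have hval : ∫ r in s..t, (Real.exp (lam * r) * ((E y).toReal - (E (u t)).toReal) -
      K * (t - r)) = (∫ r in s..t, Real.exp (lam * r)) * ((E y).toReal - (E (u t)).toReal) -
      K * ((t - s) ^ 2 / 2) := by
    rw [intervalIntegral.integral_sub (Continuous.intervalIntegrable (by fun_prop) _ _)
      (Continuous.intervalIntegrable (by fun_prop) _ _), intervalIntegral.integral_mul_const,
      intervalIntegral.integral_const_mul, intervalIntegral.integral_comp_sub_left (fun r => r),
      integral_id]
    ring
  rw [← hval]
  refine (h.evi s t y hs hst hy).trans (intervalIntegral.integral_mono_on hst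
    (intervalIntegrable_exp_mul_sub (h.antitoneOn.mono (uIcc_subset_Ioi_zero hs hst)) _)
    (Continuous.intervalIntegrable (by fun_prop) _ _) fun r hr => ?_)
  have htr : 0 ≤ t - r := sub_nonneg.2 hr.2
  have hK : K * (t - r) ≤ Real.exp (lam * r) *
      (ℓ ^ 2 * Real.exp (-(2 * |lam| * (t - r))) * (t - r)) := by
    have hexp : lam * s ≤ lam * r + |lam| * (t - s) :=
      mul_le_mul_add_abs_mul lam (abs_le.2 ⟨by linarith [hr.2], by linarith [hr.1]⟩)
    have hrs : |lam| * (t - r) ≤ |lam| * (t - s) := by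
      gcongr
      exact hr.1
    have hexp' : lam * s - 3 * |lam| * (t - s) ≤ lam * r + -(2 * |lam| * (t - r)) := by
      linarith
    calc K * (t - r)
        ≤ Real.exp (lam * r + -(2 * |lam| * (t - r))) * ℓ ^ 2 * (t - r) :=
          mul_le_mul_of_nonneg_right
            (mul_le_mul_of_nonneg_right (Real.exp_le_exp.2 hexp') (sq_nonneg ℓ)) htr
      _ = _ := by rw [Real.exp_add]; ring
  have hdrop := mul_le_mul_of_nonneg_left
    (h.globalSlope_sq_mul_le hbot hlsc (hs.trans_le hr.1) hr.2) (Real.exp_pos (lam * r)).le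
  linarith

end Integrated

/-- `E` is a proper lower semicontinuous function which has an `EVI_lam`-gradient flow from every
point, so that `semigroup E lam` consists of the flows of `E`. -/
structure GeneratesEVIFlow (E : X → EReal) (lam : ℝ) : Prop where
  ne_bot : ∀ x, E x ≠ ⊥
  lsc : LowerSemicontinuous E
  exists_ne_top : ∃ z, E z ≠ ⊤
  exists_flow : ∀ x : X, ∃ γ : ℝ → X, IsEVIFlowFrom E lam x γ

theorem StandingAssumptions.generatesEVIFlow [Nonempty X] {E : X → EReal} {lam : ℝ}
    (hE : StandingAssumptions E lam) : GeneratesEVIFlow E lam where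
  ne_bot := hE.ne_bot
  lsc := hE.lsc
  exists_ne_top := hE.dense_domain.nonempty
  exists_flow := hE.exists_flow

theorem integral_exp_mul_eq (lam s t : ℝ) :
    ∫ r in s..t, Real.exp (lam * r) =
      Real.exp (lam * s) * ∫ r in (0 : ℝ)..(t - s), Real.exp (lam * r) := by
  have hshift := intervalIntegral.integral_comp_add_right (fun r => Real.exp (lam * r)) s
    (a := 0) (b := t - s)
  rw [zero_add, sub_add_cancel] at hshift
  simp only [← hshift, ← intervalIntegral.integral_const_mul, ← Real.exp_add, mul_add,
    add_comm (lam * s)]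

section Semigroup

variable {E : X → EReal} {lam : ℝ}

theorem semigroup_zero (x : X) : semigroup E lam 0 x = x :=
  dif_neg fun h => h.1.false

theorem GeneratesEVIFlow.exists_integratedEVI (hE : GeneratesEVIFlow E lam) (x : X) :
    ∃ u : ℝ → X, IntegratedEVI E lam u ∧ Tendsto u (𝓝[>] 0) (𝓝 x) ∧
      ∀ t, 0 < t → semigroup E lam t x = u t := by
  have hu := (hE.exists_flow x).choose_spec
  refine ⟨_, hu.integratedEVI hE.ne_bot hE.lsc hE.exists_ne_top, hu.tendsto_start, fun t ht => ?_⟩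
  rw [semigroup, dif_pos ⟨ht, hE.exists_flow x⟩]

theorem GeneratesEVIFlow.energy_semigroup_ne_top (hE : GeneratesEVIFlow E lam) (x : X) {t : ℝ}
    (ht : 0 < t) : E (semigroup E lam t x) ≠ ⊤ := by
  obtain ⟨u, hu, -, hS⟩ := hE.exists_integratedEVI x
  exact hS t ht ▸ hu.energy_ne_top t ht

theorem GeneratesEVIFlow.globalSlope_semigroup_ne_top (hE : GeneratesEVIFlow E lam) (x : X)
    {t : ℝ} (ht : 0 < t) : globalSlope E lam (semigroup E lam t x) ≠ ⊤ := by
  obtain ⟨u, hu, -, hS⟩ := hE.exists_integratedEVI x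
  exact hS t ht ▸ hu.globalSlope_ne_top hE.ne_bot hE.lsc ht

theorem GeneratesEVIFlow.tendsto_semigroup_nhdsGT_zero (hE : GeneratesEVIFlow E lam) (x : X) :
    Tendsto (fun t => semigroup E lam t x) (𝓝[>] 0) (𝓝 x) := by
  obtain ⟨u, -, hu, hS⟩ := hE.exists_integratedEVI x
  exact hu.congr' (eventually_nhdsWithin_of_forall fun t ht => (hS t ht).symm)

theorem GeneratesEVIFlow.continuousOn_semigroup (hE : GeneratesEVIFlow E lam) (x : X) :
    ContinuousOn (fun t => semigroup E lam t x) (Ici 0) := by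
  obtain ⟨u, hu, -, hS⟩ := hE.exists_integratedEVI x
  intro t ht
  obtain rfl | hpos := (mem_Ici.1 ht).eq_or_lt
  · rw [← Ioi_insert, continuousWithinAt_insert_self, ContinuousWithinAt, semigroup_zero]
    exact hE.tendsto_semigroup_nhdsGT_zero x
  · refine ((hu.continuousOn.continuousAt (Ioi_mem_nhds hpos)).congr ?_).continuousWithinAt
    filter_upwards [Ioi_mem_nhds hpos] with r hr using (hS r hr).symm

theorem GeneratesEVIFlow.contraction (hE : GeneratesEVIFlow E lam) (x y : X) {t : ℝ}
    (ht : 0 ≤ t) :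
    Real.exp (lam * t) * dist (semigroup E lam t x) (semigroup E lam t y) ≤ dist x y := by
  obtain rfl | hpos := ht.eq_or_lt
  · simp [semigroup_zero]
  obtain ⟨u, hu, hux, hSu⟩ := hE.exists_integratedEVI x
  obtain ⟨w, hw, hwy, hSw⟩ := hE.exists_integratedEVI y
  rw [hSu t hpos, hSw t hpos]
  have hexp : Tendsto (fun a => Real.exp (lam * a)) (𝓝[>] 0) (𝓝 1) := by
    have hcont : Continuous fun a => Real.exp (lam * a) := by fun_prop
    simpa using (hcont.tendsto 0).mono_left (nhdsWithin_le_nhds (s := Ioi 0))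
  have hlim := hexp.mul (hux.dist hwy)
  rw [one_mul] at hlim
  refine ge_of_tendsto hlim ?_
  filter_upwards [Ioo_mem_nhdsGT hpos] with a ha using hu.contraction hw ha.1 ha.2.le

theorem GeneratesEVIFlow.dist_semigroup_le (hE : GeneratesEVIFlow E lam) (x y : X) {t : ℝ}
    (ht : 0 ≤ t) :
    dist (semigroup E lam t x) (semigroup E lam t y) ≤ Real.exp (|lam| * t) * dist x y := by
  have hexp : 1 ≤ Real.exp (|lam| * t) * Real.exp (lam * t) := by
    rw [← Real.exp_add, Real.one_le_exp_iff, ← add_mul]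
    exact mul_nonneg (by linarith [neg_abs_le lam]) ht
  calc dist (semigroup E lam t x) (semigroup E lam t y)
      ≤ Real.exp (|lam| * t) * Real.exp (lam * t) *
        dist (semigroup E lam t x) (semigroup E lam t y) := le_mul_of_one_le_left dist_nonneg hexp
    _ ≤ Real.exp (|lam| * t) * dist x y := by
        rw [mul_assoc]
        exact mul_le_mul_of_nonneg_left (hE.contraction x y ht) (Real.exp_pos _).le

theorem GeneratesEVIFlow.continuousOn_uncurry_semigroup (hE : GeneratesEVIFlow E lam) :
    ContinuousOn (fun p : ℝ × X => semigroup E lam p.1 p.2) (Ici 0 ×ˢ univ) := by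
  rintro ⟨t, x⟩ ⟨ht, -⟩
  have htime : Tendsto (fun p : ℝ × X => semigroup E lam p.1 x) (𝓝[Ici 0 ×ˢ univ] (t, x))
      (𝓝 (semigroup E lam t x)) :=
    (hE.continuousOn_semigroup x t ht).tendsto.comp
      (continuousWithinAt_fst.tendsto_nhdsWithin fun p hp => hp.1)
  have hspace : Tendsto (fun p : ℝ × X => Real.exp (|lam| * p.1) * dist p.2 x)
      (𝓝[Ici 0 ×ˢ univ] (t, x)) (𝓝 0) := by
    have hcont : Continuous fun p : ℝ × X => Real.exp (|lam| * p.1) * dist p.2 x := by fun_prop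
    simpa using (hcont.tendsto (t, x)).mono_left (nhdsWithin_le_nhds (s := Ici 0 ×ˢ univ))
  have hsum := hspace.add (tendsto_iff_dist_tendsto_zero.1 htime)
  rw [add_zero] at hsum
  refine tendsto_iff_dist_tendsto_zero.2
    (squeeze_zero' (Eventually.of_forall fun _ => dist_nonneg) ?_ hsum)
  filter_upwards [self_mem_nhdsWithin] with p hp
  exact (dist_triangle _ (semigroup E lam p.1 x) _).trans
    (add_le_add (hE.dist_semigroup_le _ _ hp.1) le_rfl)

theorem IntegratedEVI.exp_mul_evi_le {u : ℝ → X} (h : IntegratedEVI E lam u)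
    (hbot : ∀ x, E x ≠ ⊥) (hlsc : LowerSemicontinuous E) {s δ : ℝ} {y : X} (hs : 0 < s)
    (hδ : 0 ≤ δ) (hy : E y ≠ ⊤) :
    Real.exp (-(3 * |lam| * δ)) *
        (dist (u (s + δ)) y ^ 2 / 2 +
          δ ^ 2 / 2 * (globalSlope E lam (u (s + δ))).toReal ^ 2) +
      (∫ r in (0 : ℝ)..δ, Real.exp (lam * r)) * ((E (u (s + δ))).toReal - (E y).toReal) ≤
      dist (u s) y ^ 2 / 2 := by
  have hevi := h.evi_globalSlope hbot hlsc hs (le_add_of_nonneg_right hδ) hy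
  rw [integral_exp_mul_eq, add_sub_cancel_left, sub_eq_add_neg (lam * s), Real.exp_add, mul_add,
    Real.exp_add] at hevi
  have hexp : Real.exp (-(3 * |lam| * δ)) ≤ Real.exp (lam * δ) := by
    rw [← neg_mul]
    exact Real.exp_le_exp.2
      (mul_le_mul_of_nonneg_right (by linarith [neg_abs_le lam, abs_nonneg lam]) hδ)
  have hdist := mul_le_mul_of_nonneg_left
    (mul_le_mul_of_nonneg_right hexp (by positivity : 0 ≤ dist (u (s + δ)) y ^ 2 / 2))
    (Real.exp_pos (lam * s)).le
  refine le_of_mul_le_mul_left ?_ (Real.exp_pos (lam * s))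
  linarith

theorem GeneratesEVIFlow.exp_mul_semigroup_evi_le (hE : GeneratesEVIFlow E lam) (x : X) {y : X}
    {s δ : ℝ} (hs : 0 ≤ s) (hδ : 0 < δ) (hy : E y ≠ ⊤) :
    Real.exp (-(3 * |lam| * δ)) *
        (dist (semigroup E lam (s + δ) x) y ^ 2 / 2 +
          δ ^ 2 / 2 * (globalSlope E lam (semigroup E lam (s + δ) x)).toReal ^ 2) +
      (∫ r in (0 : ℝ)..δ, Real.exp (lam * r)) *
        ((E (semigroup E lam (s + δ) x)).toReal - (E y).toReal) ≤
      dist (semigroup E lam s x) y ^ 2 / 2 := by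
  obtain ⟨u, hu, hux, hS⟩ := hE.exists_integratedEVI x
  rw [hS (s + δ) (by linarith)]
  obtain rfl | hpos := hs.eq_or_lt
  swap
  · rw [hS s hpos]
    exact hu.exp_mul_evi_le hE.ne_bot hE.lsc hpos hδ.le hy
  rw [semigroup_zero, zero_add]
  -- Start the flow at time `r` and let `r → 0`, with the final time `δ` fixed.
  have hleft : Continuous fun r => Real.exp (-(3 * |lam| * (δ - r))) *
        (dist (u δ) y ^ 2 / 2 + (δ - r) ^ 2 / 2 * (globalSlope E lam (u δ)).toReal ^ 2) +
      (∫ q in (0 : ℝ)..(δ - r), Real.exp (lam * q)) * ((E (u δ)).toReal - (E y).toReal) := by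
    have hprim : Continuous fun b => ∫ q in (0 : ℝ)..b, Real.exp (lam * q) :=
      intervalIntegral.continuous_primitive (fun a b => intervalIntegrable_exp_mul a b) 0
    have := hprim.comp (by fun_prop : Continuous fun r => δ - r)
    fun_prop
  have hright := ((hux.dist (tendsto_const_nhds (x := y))).pow 2).div_const 2
  have hlim := le_of_tendsto_of_tendsto ((hleft.tendsto 0).mono_left nhdsWithin_le_nhds) hright <|
    by
      filter_upwards [Ioo_mem_nhdsGT hδ] with r hr
      have hevi := hu.exp_mul_evi_le hE.ne_bot hE.lsc hr.1 (sub_nonneg.2 hr.2.le) hy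
      rwa [add_sub_cancel] at hevi
  simpa only [sub_zero] using hlim

theorem GeneratesEVIFlow.semigroup_comparison (hE : GeneratesEVIFlow E lam) (p q : X) {h δ : ℝ}
    (hh : 0 ≤ h) (hδ : 0 < δ) (hq : E (semigroup E lam h q) ≠ ⊤) :
    Real.exp (-(3 * |lam| * δ)) *
        (dist (semigroup E lam (h + δ) p) (semigroup E lam h q) ^ 2 / 2 +
          δ ^ 2 / 2 * (globalSlope E lam (semigroup E lam (h + δ) p)).toReal ^ 2) +
      (∫ r in (0 : ℝ)..δ, Real.exp (lam * r)) *
        ((E (semigroup E lam (h + δ) p)).toReal - (E (semigroup E lam h q)).toReal) ≤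
      Real.exp (2 * |lam| * h) * (dist p q ^ 2 / 2) := by
  refine (hE.exp_mul_semigroup_evi_le p hh hδ hq).trans ?_
  have hsq := pow_le_pow_left₀ dist_nonneg (hE.dist_semigroup_le p q hh) 2
  rw [mul_pow, ← Real.exp_nat_mul, Nat.cast_ofNat, ← mul_assoc] at hsq
  linarith

end Semigroup

/-! ### Energy functions of curves -/

section EnergyFunction

theorem enorm_deriv_dist_le_metricSpeed (f : ℝ → X) (y : X) (t : ℝ) :
    ‖deriv (fun s => dist (f s) y) t‖ₑ ≤ metricSpeed f t := by
  by_cases hd : DifferentiableAt ℝ (fun s => dist (f s) y) t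
  swap
  · simp [deriv_zero_of_not_differentiableAt hd]
  rw [← (hasDerivAt_iff_tendsto_slope.1 hd.hasDerivAt).enorm.limsup_eq]
  refine limsup_le_limsup ?_
  filter_upwards [self_mem_nhdsWithin] with s hs
  rw [slope_def_field, div_eq_mul_inv, enorm_mul, enorm_inv (sub_ne_zero.2 hs), ← div_eq_mul_inv,
    ← edist_eq_enorm_sub, ← edist_eq_enorm_sub, edist_dist, edist_dist (f s)]
  gcongr
  exact dist_dist_dist_le_left _ _ _

theorem sq_lintegral_le_measure_univ_mul {α : Type*} [MeasurableSpace α] (μ : Measure α)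
    {F : α → ℝ≥0∞} (hF : AEMeasurable F μ) :
    (∫⁻ x, F x ∂μ) ^ 2 ≤ μ univ * ∫⁻ x, F x ^ 2 ∂μ := by
  have holder := ENNReal.lintegral_mul_le_Lp_mul_Lq μ Real.HolderConjugate.two_two
    aemeasurable_const hF (f := 1)
  simp only [Pi.mul_apply, Pi.one_apply, one_mul, ENNReal.one_rpow, lintegral_one] at holder
  calc (∫⁻ x, F x ∂μ) ^ 2
      ≤ (μ univ ^ (1 / 2 : ℝ) * (∫⁻ x, F x ^ (2 : ℝ) ∂μ) ^ (1 / 2 : ℝ)) ^ 2 := by gcongr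
    _ = μ univ * ∫⁻ x, F x ^ 2 ∂μ := by
      rw [mul_pow, ← ENNReal.rpow_mul_natCast, ← ENNReal.rpow_mul_natCast]
      norm_num

theorem edist_sq_le_lintegral_metricSpeed_sq {f : ℝ → X} {s t : ℝ} (hst : s ≤ t)
    (hf : AbsolutelyContinuousOnInterval f s t) :
    edist (f s) (f t) ^ 2 ≤ ENNReal.ofReal (t - s) * ∫⁻ r in Ioc s t, metricSpeed f r ^ 2 := by
  set g : ℝ → ℝ := fun r => dist (f r) (f s)
  have ftc : ∫ r in Ioc s t, deriv g r = dist (f s) (f t) := by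
    rw [← intervalIntegral.integral_of_le hst,
      (absolutelyContinuousOnInterval_dist_const hf (f s)).integral_deriv_eq_sub]
    simp [dist_comm]
  have edist_le : edist (f s) (f t) ≤ ∫⁻ r in Ioc s t, ‖deriv g r‖ₑ := by
    rw [edist_dist, ← ftc, ← Real.enorm_of_nonneg (ftc ▸ dist_nonneg)]
    exact enorm_integral_le_lintegral_enorm _
  calc edist (f s) (f t) ^ 2 ≤ (∫⁻ r in Ioc s t, ‖deriv g r‖ₑ) ^ 2 := by gcongr
    _ ≤ ENNReal.ofReal (t - s) * ∫⁻ r in Ioc s t, ‖deriv g r‖ₑ ^ 2 := by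
      simpa using sq_lintegral_le_measure_univ_mul (volume.restrict (Ioc s t))
        (measurable_deriv g).enorm.aemeasurable
    _ ≤ _ := by
      gcongr with r
      exact enorm_deriv_dist_le_metricSpeed f (f s) r

/-- `v` is an energy function for `f` and `G` on `[a, b]`: a monotone function whose increments
bound, in the integrated Cauchy-Schwarz form, the quantity `∫ (|ḟ|² + G)`. Only the smaller of the
two endpoint values of `G` occurs. Taking `G = 0` gives the energy functions of the curve `f`
itself. -/
structure IsEnergyFunction (f : ℝ → X) (G : ℝ → ℝ≥0∞) (v : ℝ → ℝ) (a b : ℝ) : Prop where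
  monotoneOn : MonotoneOn v (Icc a b)
  edist_sq_add_le : ∀ s t, a ≤ s → s ≤ t → t ≤ b →
    edist (f s) (f t) ^ 2 + ENNReal.ofReal ((t - s) ^ 2) * min (G s) (G t) ≤
      ENNReal.ofReal ((t - s) * (v t - v s))

theorem isEnergyFunction_lintegral_metricSpeed_sq {f : ℝ → X} {a b : ℝ}
    (hf : AbsolutelyContinuousOnInterval f a b) (hab : a ≤ b)
    (hfin : ∫⁻ r in Ioc a b, metricSpeed f r ^ 2 ≠ ⊤) :
    IsEnergyFunction f 0 (fun t => (∫⁻ r in Ioc a t, metricSpeed f r ^ 2).toReal) a b := by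
  have hfin' : ∀ t ≤ b, ∫⁻ r in Ioc a t, metricSpeed f r ^ 2 ≠ ⊤ := fun t ht =>
    ne_top_of_le_ne_top hfin (lintegral_mono_set (Ioc_subset_Ioc_right ht))
  refine ⟨fun s _ t ht hst => ENNReal.toReal_mono (hfin' t ht.2)
    (lintegral_mono_set (Ioc_subset_Ioc_right hst)), fun s t hs hst ht => ?_⟩
  have hsplit : ∫⁻ r in Ioc a t, metricSpeed f r ^ 2 =
      (∫⁻ r in Ioc a s, metricSpeed f r ^ 2) + ∫⁻ r in Ioc s t, metricSpeed f r ^ 2 := by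
    rw [← Ioc_union_Ioc_eq_Ioc hs hst,
      lintegral_union measurableSet_Ioc (Ioc_disjoint_Ioc_of_le le_rfl)]
  have hfin_st : ∫⁻ r in Ioc s t, metricSpeed f r ^ 2 ≠ ⊤ :=
    ne_top_of_le_ne_top hfin (lintegral_mono_set (Ioc_subset_Ioc hs ht))
  have hac : AbsolutelyContinuousOnInterval f s t := hf.mono (by
    rw [uIcc_of_le hst, uIcc_of_le hab]; exact Icc_subset_Icc hs ht)
  rw [hsplit, ENNReal.toReal_add (hfin' s (hst.trans ht)) hfin_st, add_sub_cancel_left,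
    ENNReal.ofReal_mul (sub_nonneg.2 hst), ENNReal.ofReal_toReal hfin_st]
  simpa using edist_sq_le_lintegral_metricSpeed_sq hst hac

variable {f : ℝ → X} {G : ℝ → ℝ≥0∞} {v w : ℝ → ℝ} {a b c s t : ℝ}

theorem isEnergyFunction_of_forall_lt
    (h : ∀ s t, a ≤ s → s < t → t ≤ b → ∃ r ∈ ({s, t} : Set ℝ), G r ≠ ⊤ ∧
      dist (f s) (f t) ^ 2 + (t - s) ^ 2 * (G r).toReal ≤ (t - s) * (v t - v s)) :
    IsEnergyFunction f G v a b := by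
  constructor
  · intro s hs t ht hst
    rcases hst.eq_or_lt with rfl | hlt
    · exact le_rfl
    obtain ⟨r, -, -, hle⟩ := h s t hs.1 hlt ht.2
    have : 0 ≤ (t - s) * (v t - v s) := le_trans (by positivity) hle
    exact sub_nonneg.1 (nonneg_of_mul_nonneg_right this (sub_pos.2 hlt))
  · intro s t hs hst ht
    rcases hst.eq_or_lt with rfl | hlt
    · simp
    obtain ⟨r, hr, hfin, hle⟩ := h s t hs hlt ht
    have hmin : min (G s) (G t) ≤ G r := by
      rcases hr with rfl | rfl
      exacts [min_le_left _ _, min_le_right _ _]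
    calc edist (f s) (f t) ^ 2 + ENNReal.ofReal ((t - s) ^ 2) * min (G s) (G t)
        ≤ edist (f s) (f t) ^ 2 + ENNReal.ofReal ((t - s) ^ 2) * G r := by gcongr
      _ = ENNReal.ofReal (dist (f s) (f t) ^ 2 + (t - s) ^ 2 * (G r).toReal) := by
        rw [ENNReal.ofReal_add (by positivity) (by positivity), ENNReal.ofReal_mul (by positivity),
          ENNReal.ofReal_toReal hfin, ENNReal.ofReal_pow dist_nonneg, edist_dist]
      _ ≤ ENNReal.ofReal ((t - s) * (v t - v s)) := ENNReal.ofReal_le_ofReal hle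

theorem IsEnergyFunction.mono (h : IsEnergyFunction f G v a b) {G' : ℝ → ℝ≥0∞} (hG : G' ≤ G) :
    IsEnergyFunction f G' v a b :=
  ⟨h.monotoneOn, fun s t hs hst ht => le_trans
    (by gcongr ?_ + ?_ * min ?_ ?_ <;> first | rfl | exact hG _) (h.edist_sq_add_le s t hs hst ht)⟩

theorem isEnergyFunction_zero_iff (hv : MonotoneOn v (Icc a b)) :
    IsEnergyFunction f 0 v a b ↔
      ∀ s t, a ≤ s → s ≤ t → t ≤ b → dist (f s) (f t) ^ 2 ≤ (t - s) * (v t - v s) := by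
  refine ⟨fun h s t hs hst ht => ?_, fun h => ⟨hv, fun s t hs hst ht => ?_⟩⟩
  · have hnonneg : 0 ≤ (t - s) * (v t - v s) := mul_nonneg (sub_nonneg.2 hst)
      (sub_nonneg.2 (hv ⟨hs, hst.trans ht⟩ ⟨hs.trans hst, ht⟩ hst))
    have := h.edist_sq_add_le s t hs hst ht
    rwa [Pi.zero_apply, Pi.zero_apply, min_self, mul_zero, add_zero, edist_dist,
      ← ENNReal.ofReal_pow dist_nonneg, ENNReal.ofReal_le_ofReal_iff hnonneg] at this
  · rw [Pi.zero_apply, Pi.zero_apply, min_self, mul_zero, add_zero, edist_dist,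
      ← ENNReal.ofReal_pow dist_nonneg]
    exact ENNReal.ofReal_le_ofReal (h s t hs hst ht)

theorem IsEnergyFunction.dist_sq_le (h : IsEnergyFunction f G v a b) (hs : a ≤ s) (hst : s ≤ t)
    (ht : t ≤ b) : dist (f s) (f t) ^ 2 ≤ (t - s) * (v t - v s) :=
  (isEnergyFunction_zero_iff h.monotoneOn).1 (h.mono fun _ => zero_le) s t hs hst ht

theorem IsEnergyFunction.dist_le_sqrt_mul_sqrt (h : IsEnergyFunction f G v a b) (hs : s ∈ Icc a b)
    (ht : t ∈ Icc a b) : dist (f s) (f t) ≤ √(dist s t) * √(dist (v s) (v t)) := by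
  wlog hst : s ≤ t generalizing s t
  · simpa only [dist_comm] using this ht hs (le_of_not_ge hst)
  rw [← Real.sqrt_mul dist_nonneg, dist_comm s, dist_comm (v s), Real.dist_eq, Real.dist_eq,
    abs_of_nonneg (sub_nonneg.2 hst), abs_of_nonneg (sub_nonneg.2 (h.monotoneOn hs ht hst))]
  exact Real.le_sqrt_of_sq_le (h.dist_sq_le hs.1 hst ht.2)

theorem sq_add_le_mul_of_sq_le {p q α β x y : ℝ} (hα : 0 ≤ α) (hβ : 0 ≤ β) (hx : 0 ≤ x)
    (hy : 0 ≤ y) (hp : p ^ 2 ≤ α * x) (hq : q ^ 2 ≤ β * y) :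
    (p + q) ^ 2 ≤ (α + β) * (x + y) := by
  have hcross : 2 * (p * q) ≤ α * y + β * x := by
    have := mul_le_mul hp hq (sq_nonneg _) (by positivity)
    refine abs_le_of_sq_le_sq' ?_ (by positivity) |>.2
    nlinarith [sq_nonneg (α * y - β * x)]
  nlinarith

/-- Both halves are followed at once, by stopping the first at `b` and starting the second there. -/
theorem IsEnergyFunction.glue (hv : IsEnergyFunction f 0 v a b) (hw : IsEnergyFunction f 0 w b c)
    (hab : a ≤ b) (hbc : b ≤ c) :
    IsEnergyFunction f 0 (fun t => v (min t b) + w (max t b)) a c := by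
  have hmin : ∀ t, a ≤ t → min t b ∈ Icc a b := fun t ht => ⟨le_min ht hab, min_le_right _ _⟩
  have hmax : ∀ t, t ≤ c → max t b ∈ Icc b c := fun t ht => ⟨le_max_right _ _, max_le ht hbc⟩
  have hmono : MonotoneOn (fun t => v (min t b) + w (max t b)) (Icc a c) := fun s hs t ht hst =>
    add_le_add (hv.monotoneOn (hmin s hs.1) (hmin t ht.1) (min_le_min_right b hst))
      (hw.monotoneOn (hmax s hs.2) (hmax t ht.2) (max_le_max_right b hst))
  refine (isEnergyFunction_zero_iff hmono).2 fun s t hs hst ht => ?_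
  have hs' := hst.trans ht
  have ht' := hs.trans hst
  have hmin_le := min_le_min_right b hst
  have hmax_le := max_le_max_right b hst
  have triangle : dist (f s) (f t) ≤
      dist (f (min s b)) (f (min t b)) + dist (f (max s b)) (f (max t b)) := by
    rcases le_total t b with htb | htb
    · simp [htb, hst.trans htb]
    rcases le_total s b with hsb | hsb
    · simp [hsb, htb, dist_triangle]
    · simp [hsb, htb]
  calc dist (f s) (f t) ^ 2
      ≤ (dist (f (min s b)) (f (min t b)) + dist (f (max s b)) (f (max t b))) ^ 2 := by gcongr
    _ ≤ ((min t b - min s b) + (max t b - max s b)) *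
        ((v (min t b) - v (min s b)) + (w (max t b) - w (max s b))) :=
      sq_add_le_mul_of_sq_le (sub_nonneg.2 hmin_le) (sub_nonneg.2 hmax_le)
        (sub_nonneg.2 (hv.monotoneOn (hmin s hs) (hmin t ht') hmin_le))
        (sub_nonneg.2 (hw.monotoneOn (hmax s hs') (hmax t ht) hmax_le))
        (hv.dist_sq_le (hmin s hs).1 hmin_le (hmin t ht').2)
        (hw.dist_sq_le (hmax s hs').1 hmax_le (hmax t ht).2)
    _ = _ := by
      linear_combination
        (v (min t b) - v (min s b) + (w (max t b) - w (max s b))) *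
          (min_add_max t b - min_add_max s b)

theorem IsEnergyFunction.absolutelyContinuousOnInterval (h : IsEnergyFunction f G v a b)
    (hab : a ≤ b) : AbsolutelyContinuousOnInterval f a b := by
  rw [absolutelyContinuousOnInterval_iff]
  intro ε hε
  have hV : 0 ≤ v b - v a :=
    sub_nonneg.2 (h.monotoneOn (left_mem_Icc.2 hab) (right_mem_Icc.2 hab) hab)
  refine ⟨ε ^ 2 / (v b - v a + 1), by positivity, fun I hI hlength => ?_⟩
  rw [lt_div_iff₀ (by positivity)] at hlength
  have hmem := hI.1
  rw [uIcc_of_le hab] at hmem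
  calc ∑ i ∈ Finset.range I.1, dist (f (I.2 i).1) (f (I.2 i).2)
      ≤ ∑ i ∈ Finset.range I.1,
          √(dist (I.2 i).1 (I.2 i).2) * √(dist (v (I.2 i).1) (v (I.2 i).2)) :=
        Finset.sum_le_sum fun i hi => h.dist_le_sqrt_mul_sqrt (hmem i hi).1 (hmem i hi).2
    _ ≤ √(∑ i ∈ Finset.range I.1, dist (I.2 i).1 (I.2 i).2) *
          √(∑ i ∈ Finset.range I.1, dist (v (I.2 i).1) (v (I.2 i).2)) :=
        Real.sum_sqrt_mul_sqrt_le _ (fun _ => dist_nonneg) fun _ => dist_nonneg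
    _ < ε := by
      rw [← Real.sqrt_mul (Finset.sum_nonneg fun _ _ => dist_nonneg), Real.sqrt_lt' hε]
      refine lt_of_le_of_lt ?_ hlength
      gcongr
      linarith [sum_dist_le_of_monotoneOn h.monotoneOn hab hI]

theorem IsEnergyFunction.sq_add_le_ofReal_slope (h : IsEnergyFunction f G v a b) (hs : s ∈ Icc a b)
    (ht : t ∈ Icc a b) (hne : s ≠ t) :
    (edist (f s) (f t) / edist s t) ^ 2 + min (G s) (G t) ≤
      ENNReal.ofReal (_root_.slope v t s) := by
  wlog hst : s ≤ t generalizing s t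
  · simpa only [slope_comm, edist_comm, min_comm] using this ht hs hne.symm (le_of_not_ge hst)
  have hpos : 0 < (t - s) ^ 2 := by have := sub_ne_zero.2 hne.symm; positivity
  have hD : edist s t ^ 2 = ENNReal.ofReal ((t - s) ^ 2) := by
    rw [edist_dist, ← ENNReal.ofReal_pow dist_nonneg, dist_comm, Real.dist_eq, sq_abs]
  have hslope : _root_.slope v t s = (t - s) * (v t - v s) / (t - s) ^ 2 := by
    have := sub_ne_zero.2 hne
    rw [slope_comm, slope_def_field]
    field_simp
  rw [hslope, ENNReal.ofReal_div_of_pos hpos, div_eq_mul_inv, mul_pow,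
    ← ENNReal.inv_pow, hD, ← div_eq_mul_inv, ENNReal.le_div_iff_mul_le
    (.inl (ENNReal.ofReal_pos.2 hpos).ne') (.inl ENNReal.ofReal_ne_top), add_mul,
    ENNReal.div_mul_cancel (ENNReal.ofReal_pos.2 hpos).ne' ENNReal.ofReal_ne_top, mul_comm]
  exact h.edist_sq_add_le s t hs.1 hst ht.2

theorem IsEnergyFunction.metricSpeed_sq_add_le (h : IsEnergyFunction f G v a b) (ht : t ∈ Ioo a b)
    (hG : LowerSemicontinuousAt G t) (hv : DifferentiableAt ℝ v t) :
    metricSpeed f t ^ 2 + G t ≤ ENNReal.ofReal (deriv v t) := by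
  have hlim := ENNReal.tendsto_ofReal (hasDerivAt_iff_tendsto_slope.1 hv.hasDerivAt)
  have hnear : ∀ᶠ s in 𝓝[≠] t, s ∈ Icc a b ∧ s ≠ t :=
    (eventually_nhdsWithin_of_eventually_nhds (Icc_mem_nhds ht.1 ht.2)).and self_mem_nhdsWithin
  have bound : ∀ c ≤ G t, (∀ᶠ s in 𝓝[≠] t, c ≤ G s) →
      metricSpeed f t ^ 2 + c ≤ ENNReal.ofReal (deriv v t) := by
    intro c hct hc
    have hmono : Monotone fun r : ℝ≥0∞ => r ^ 2 + c := fun _ _ hr => by dsimp only; gcongr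
    rw [metricSpeed, hmono.map_limsup_of_continuousAt _
      ((ENNReal.continuous_pow 2).add continuous_const).continuousAt, ← hlim.limsup_eq]
    refine limsup_le_limsup ?_
    filter_upwards [hnear, hc] with s hs hcs
    exact (add_le_add_right (le_min hcs hct) _).trans
      (h.sq_add_le_ofReal_slope hs.1 (Ioo_subset_Icc_self ht) hs.2)
  have hspeed : metricSpeed f t ^ 2 ≤ ENNReal.ofReal (deriv v t) := by
    simpa using bound 0 zero_le (by simp)
  rw [add_comm, ← ENNReal.le_sub_iff_add_le_right (ne_top_of_le_ne_top ENNReal.ofReal_ne_top hspeed)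
    hspeed]
  refine le_of_forall_lt_imp_le_of_dense fun c hc => ?_
  refine ENNReal.le_sub_of_add_le_left (ne_top_of_le_ne_top ENNReal.ofReal_ne_top hspeed) ?_
  exact bound c hc.le (eventually_nhdsWithin_of_eventually_nhds ((hG c hc).mono fun _ => le_of_lt))

theorem lintegral_deriv_le_of_monotoneOn (hv : MonotoneOn v (Icc a b)) (hab : a ≤ b) :
    ∫⁻ t in Ioo a b, ENNReal.ofReal (deriv v t) ≤ ENNReal.ofReal (v b - v a) := by
  have hv' : MonotoneOn v (uIcc a b) := by rwa [uIcc_of_le hab]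
  have hV : 0 ≤ v b - v a := sub_nonneg.2 (hv (left_mem_Icc.2 hab) (right_mem_Icc.2 hab) hab)
  have hmem := hv'.intervalIntegral_deriv_mem_uIcc
  rw [uIcc_of_le hV, intervalIntegral.integral_of_le hab, integral_Ioc_eq_integral_Ioo] at hmem
  rw [← ofReal_integral_eq_lintegral_ofReal
    ((intervalIntegrable_iff_integrableOn_Ioo_of_le hab).1 hv'.intervalIntegrable_deriv)]
  · exact ENNReal.ofReal_le_ofReal hmem.2
  · filter_upwards [ae_restrict_mem measurableSet_Ioo] with t ht
    rw [Pi.zero_apply, ← derivWithin_of_mem_nhds (Icc_mem_nhds ht.1 ht.2)]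
    exact hv.derivWithin_nonneg

theorem IsEnergyFunction.lintegral_le (h : IsEnergyFunction f G v a b) (hab : a ≤ b)
    (hG : ∀ t ∈ Ioo a b, LowerSemicontinuousAt G t) :
    ∫⁻ t in Ioo a b, (metricSpeed f t ^ 2 + G t) ≤ ENNReal.ofReal (v b - v a) := by
  refine le_trans (lintegral_mono_ae ?_) (lintegral_deriv_le_of_monotoneOn h.monotoneOn hab)
  filter_upwards [ae_restrict_mem measurableSet_Ioo,
    ae_restrict_of_ae h.monotoneOn.ae_differentiableWithinAt_of_mem] with t ht hdiff
  exact h.metricSpeed_sq_add_le ht (hG t ht)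
    ((hdiff (Ioo_subset_Icc_self ht)).differentiableAt (Icc_mem_nhds ht.1 ht.2))

theorem IsEnergyFunction.lintegral_add_le (hv : IsEnergyFunction f G v a b)
    (hw : IsEnergyFunction f G w b c) (hab : a ≤ b) (hbc : b ≤ c) (hG : LowerSemicontinuous G) :
    ∫⁻ t in Icc a c, (metricSpeed f t ^ 2 + G t) ≤
      ENNReal.ofReal (v b - v a + (w c - w b)) := by
  have hV := sub_nonneg.2
    (hv.monotoneOn (left_mem_Icc.2 hab) (right_mem_Icc.2 hab) hab)
  have hW := sub_nonneg.2
    (hw.monotoneOn (left_mem_Icc.2 hbc) (right_mem_Icc.2 hbc) hbc)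
  rw [← Icc_union_Icc_eq_Icc hab hbc, ENNReal.ofReal_add hV hW]
  refine (lintegral_union_le _ _ _).trans (add_le_add ?_ ?_)
  · rw [← restrict_Ioo_eq_restrict_Icc]
    exact hv.lintegral_le hab fun t _ => hG t
  · rw [← restrict_Ioo_eq_restrict_Icc]
    exact hw.lintegral_le hbc fun t _ => hG t

theorem continuous_extend (γ : Curve X) : Continuous (extend γ) :=
  γ.continuous.comp continuous_projIcc

theorem kineticEnergy_le_of_isEnergyFunction {γ : Curve X}
    (h : IsEnergyFunction (extend γ) 0 v 0 1) :
    kineticEnergy γ ≤ ENNReal.ofReal ((v 1 - v 0) / 2) := by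
  have hlint := h.lintegral_le zero_le_one fun _ _ => lowerSemicontinuousAt_const
  rw [kineticEnergy, if_pos (h.absolutelyContinuousOnInterval zero_le_one), div_eq_inv_mul,
    ENNReal.ofReal_mul (by norm_num), one_div, ENNReal.ofReal_inv_of_pos two_pos,
    ENNReal.ofReal_ofNat, ← restrict_Ioo_eq_restrict_Icc]
  gcongr
  simpa using hlint

theorem exists_isEnergyFunction_of_kineticEnergy_ne_top {γ : Curve X} (hγ : kineticEnergy γ ≠ ⊤) :
    ∃ v : ℝ → ℝ, IsEnergyFunction (extend γ) 0 v 0 1 ∧ v 0 = 0 ∧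
      v 1 = 2 * (kineticEnergy γ).toReal := by
  unfold kineticEnergy at hγ ⊢
  split_ifs at hγ ⊢ with hac
  swap
  · exact absurd rfl hγ
  rw [restrict_Ioc_eq_restrict_Icc.symm] at hγ ⊢
  have hfin : ∫⁻ r in Ioc (0 : ℝ) 1, metricSpeed (extend γ) r ^ 2 ≠ ⊤ := fun htop => by
    simp [htop] at hγ
  exact ⟨_, isEnergyFunction_lintegral_metricSpeed_sq hac zero_le_one hfin, by simp, by simp⟩

theorem isEnergyFunction_of_tendsto {ι : Type*} {l : Filter ι} [l.NeBot] {u : ι → ℝ → X}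
    {v : ι → ℝ → ℝ} {f : ℝ → X} {w : ℝ → ℝ} {a b : ℝ}
    (hv : ∀ᶠ n in l, IsEnergyFunction (u n) 0 (v n) a b)
    (hw : ∀ t ∈ Icc a b, Tendsto (fun n => v n t) l (𝓝 (w t)))
    (hf : ∀ s ∈ Icc a b, ∀ t ∈ Icc a b,
      edist (f s) (f t) ≤ liminf (fun n => edist (u n s) (u n t)) l) :
    IsEnergyFunction f 0 w a b := by
  have hmono : MonotoneOn w (Icc a b) := fun s hs t ht hst =>
    le_of_tendsto_of_tendsto (hw s hs) (hw t ht) (hv.mono fun _ h => h.monotoneOn hs ht hst)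
  refine (isEnergyFunction_zero_iff hmono).2 fun s t hs hst ht => ?_
  have hs' : s ∈ Icc a b := ⟨hs, hst.trans ht⟩
  have ht' : t ∈ Icc a b := ⟨hs.trans hst, ht⟩
  have hlim : Tendsto (fun n => ENNReal.ofReal √((t - s) * (v n t - v n s))) l
      (𝓝 (ENNReal.ofReal √((t - s) * (w t - w s)))) :=
    ENNReal.tendsto_ofReal (((hw t ht').sub (hw s hs')).const_mul (t - s)).sqrt
  have hle : edist (f s) (f t) ≤ ENNReal.ofReal √((t - s) * (w t - w s)) := by
    refine (hf s hs' t ht').trans (hlim.liminf_eq ▸ liminf_le_liminf ?_)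
    filter_upwards [hv] with n hn
    rw [edist_dist]
    exact ENNReal.ofReal_le_ofReal (Real.le_sqrt_of_sq_le (hn.dist_sq_le hs hst ht))
  rw [edist_dist, ENNReal.ofReal_le_ofReal_iff (Real.sqrt_nonneg _)] at hle
  exact (Real.le_sqrt dist_nonneg (mul_nonneg (sub_nonneg.2 hst)
    (sub_nonneg.2 (hmono hs' ht' hst)))).1 hle

/-- Energy functions of the curves `u n`, normalised to vanish at `0`, take values in a compact
interval, hence converge pointwise along an ultrafilter; the limit is an energy function of `γ`. -/
theorem kineticEnergy_le_of_frequently_lt {u : ℕ → Curve X} {γ : Curve X}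
    (h : ∀ s t, edist (γ s) (γ t) ≤ liminf (fun n => edist (u n s) (u n t)) atTop) {c : NNReal}
    (hc : ∃ᶠ n in atTop, kineticEnergy (u n) < c) : kineticEnergy γ ≤ c := by
  have : (atTop ⊓ 𝓟 {n | kineticEnergy (u n) < c}).NeBot := frequently_mem_iff_neBot.1 hc
  obtain ⟨U, hU⟩ := Ultrafilter.exists_le (atTop ⊓ 𝓟 {n | kineticEnergy (u n) < c})
  have hUc : ∀ᶠ n in U, kineticEnergy (u n) < c := hU (mem_inf_of_right (mem_principal_self _))
  choose! v hv hv0 hv1 using fun n (hn : kineticEnergy (u n) < c) =>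
    exists_isEnergyFunction_of_kineticEnergy_ne_top hn.ne_top
  have hvmem : ∀ t ∈ Icc (0 : ℝ) 1, ∀ᶠ n in U, v n t ∈ Icc (0 : ℝ) (2 * c) := fun t ht => by
    filter_upwards [hUc] with n hn
    have hle : (kineticEnergy (u n)).toReal ≤ c := by
      simpa using ENNReal.toReal_mono ENNReal.coe_ne_top hn.le
    have h0 := (hv n hn).monotoneOn (left_mem_Icc.2 zero_le_one) ht ht.1
    have h1 := (hv n hn).monotoneOn ht (right_mem_Icc.2 zero_le_one) ht.2
    rw [hv0 n hn] at h0
    rw [hv1 n hn] at h1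
    exact ⟨h0, by linarith⟩
  choose! w hwmem hw using fun t ht =>
    isCompact_Icc.ultrafilter_le_nhds (U.map (v · t)) (le_principal_iff.2 (hvmem t ht))
  have hw_energy : IsEnergyFunction (extend γ) 0 w 0 1 :=
    isEnergyFunction_of_tendsto (hUc.mono hv) hw fun s _ t _ =>
      (h _ _).trans (liminf_le_liminf_of_le (hU.trans inf_le_left))
  refine (kineticEnergy_le_of_isEnergyFunction hw_energy).trans ?_
  rw [← ENNReal.ofReal_coe_nnreal]
  have h0 := (hwmem 0 (left_mem_Icc.2 zero_le_one)).1
  have h1 := (hwmem 1 (right_mem_Icc.2 zero_le_one)).2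
  exact ENNReal.ofReal_le_ofReal (by linarith)

theorem kineticEnergy_le_liminf {u : ℕ → Curve X} {γ : Curve X}
    (h : ∀ s t, edist (γ s) (γ t) ≤ liminf (fun n => edist (u n s) (u n t)) atTop) :
    kineticEnergy γ ≤ liminf (fun n => kineticEnergy (u n)) atTop := by
  refine le_of_forall_gt_imp_ge_of_dense fun c hc => ?_
  rcases eq_or_ne c ⊤ with rfl | hctop
  · exact le_top
  lift c to NNReal using hctop
  exact kineticEnergy_le_of_frequently_lt h (frequently_lt_of_liminf_lt (by isBoundedDefault) hc)

end EnergyFunction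

/-! ### Recovery curves -/

section RecoveryCurve

variable {E : X → EReal} {lam ε η : ℝ}

theorem le_exp_abs_mul_integral_exp_mul {δ : ℝ} (hδ : 0 ≤ δ) :
    δ ≤ Real.exp (|lam| * δ) * ∫ r in (0 : ℝ)..δ, Real.exp (lam * r) := by
  rw [← intervalIntegral.integral_const_mul]
  calc δ = ∫ _ in (0 : ℝ)..δ, (1 : ℝ) := by simp
    _ ≤ ∫ r in (0 : ℝ)..δ, Real.exp (|lam| * δ) * Real.exp (lam * r) := by
      refine intervalIntegral.integral_mono_on hδ intervalIntegrable_const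
        ((intervalIntegrable_exp_mul 0 δ).const_mul _) fun r hr => ?_
      rw [← Real.exp_add, Real.one_le_exp_iff]
      have hle : |lam| * r ≤ |lam| * δ := mul_le_mul_of_nonneg_left hr.2 (abs_nonneg lam)
      have hge : -|lam| * r ≤ lam * r := mul_le_mul_of_nonneg_right (neg_abs_le lam) hr.1
      linarith

theorem le_exp_mul_of_exp_neg_mul_le {L T h δ J D d Δ : ℝ} (hL : 0 ≤ L) (hh : 0 ≤ h) (hδ : 0 < δ)
    (hT : h + δ ≤ T) (hJ_ge : δ ≤ Real.exp (L * δ) * J) (hJ_le : J ≤ Real.exp (L * δ) * δ)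
    (hD : 0 ≤ D) (hd : 0 ≤ d)
    (hcomp : Real.exp (-(3 * L * δ)) * D ≤ Real.exp (2 * L * h) * d + 2 * J * Δ) :
    D ≤ Real.exp (4 * L * T) * (Real.exp (2 * L * T) * d + 2 * δ * Δ) := by
  have hJ : 0 < J := pos_of_mul_pos_right (hδ.trans_le hJ_ge) (Real.exp_pos _).le
  set B := Real.exp (2 * L * T) * d + 2 * δ * Δ with hB
  have hJB : δ * (Real.exp (-(3 * L * δ)) * D) ≤ J * B := by
    calc δ * (Real.exp (-(3 * L * δ)) * D)
        ≤ δ * (Real.exp (2 * L * h) * d + 2 * J * Δ) := by gcongr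
      _ = δ * (Real.exp (2 * L * h) * d) + J * (2 * δ * Δ) := by ring
      _ ≤ Real.exp (L * δ) * J * (Real.exp (2 * L * h) * d) + J * (2 * δ * Δ) := by gcongr
      _ = J * (Real.exp (L * δ + 2 * L * h) * d + 2 * δ * Δ) := by rw [Real.exp_add]; ring
      _ ≤ J * B := by
        rw [hB]
        gcongr
        nlinarith
  have hB0 : 0 ≤ B := nonneg_of_mul_nonneg_right (le_trans (by positivity) hJB) hJ
  have hDB : Real.exp (-(3 * L * δ)) * D ≤ Real.exp (L * δ) * B := by
    refine le_of_mul_le_mul_left (hJB.trans ?_) hδ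
    linarith [mul_le_mul_of_nonneg_right hJ_le hB0]
  calc D = Real.exp (3 * L * δ) * (Real.exp (-(3 * L * δ)) * D) := by
        rw [← mul_assoc, ← Real.exp_add, add_neg_cancel, Real.exp_zero, one_mul]
    _ ≤ Real.exp (3 * L * δ) * (Real.exp (L * δ) * B) := by gcongr
    _ = Real.exp (4 * L * δ) * B := by
        rw [← mul_assoc, ← Real.exp_add]
        ring_nf
    _ ≤ Real.exp (4 * L * T) * B := by
        gcongr
        linarith

theorem GeneratesEVIFlow.dist_sq_add_globalSlope_sq_le (hE : GeneratesEVIFlow E lam) (p q : X)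
    {h δ T : ℝ} (hh : 0 ≤ h) (hδ : 0 < δ) (hT : h + δ ≤ T) (hq : E (semigroup E lam h q) ≠ ⊤) :
    dist (semigroup E lam (h + δ) p) (semigroup E lam h q) ^ 2 +
        δ ^ 2 * (globalSlope E lam (semigroup E lam (h + δ) p)).toReal ^ 2 ≤
      Real.exp (4 * |lam| * T) * (Real.exp (2 * |lam| * T) * dist p q ^ 2 +
        2 * δ * ((E (semigroup E lam h q)).toReal -
          (E (semigroup E lam (h + δ) p)).toReal)) := by
  have hJ_le := integral_exp_mul_le (lam := lam) le_rfl hδ.le le_rfl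
  rw [sub_zero] at hJ_le
  refine le_exp_mul_of_exp_neg_mul_le (abs_nonneg lam) hh hδ hT
    (le_exp_abs_mul_integral_exp_mul hδ.le) hJ_le (by positivity) (by positivity) ?_
  linarith [hE.semigroup_comparison p q hh hδ hq]

theorem GeneratesEVIFlow.action_le_of_isEnergyFunction (hE : GeneratesEVIFlow E lam) {γ : Curve X}
    {v w : ℝ → ℝ} {m : ℝ} (hm0 : 0 ≤ m) (hm1 : m ≤ 1)
    (hv : IsEnergyFunction (extend γ)
      (fun t => ENNReal.ofReal (ε ^ 2) * globalSlope E lam (extend γ t) ^ 2) v 0 m)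
    (hw : IsEnergyFunction (extend γ)
      (fun t => ENNReal.ofReal (ε ^ 2) * globalSlope E lam (extend γ t) ^ 2) w m 1) :
    action E ε γ ≤ ENNReal.ofReal ((v m - v 0 + (w 1 - w m)) / 2) := by
  set G : ℝ → ℝ≥0∞ := fun t => ENNReal.ofReal (ε ^ 2) * globalSlope E lam (extend γ t) ^ 2
  have hG : LowerSemicontinuous G := by
    have hslope := (lowerSemicontinuous_globalSlope (lam := lam) hE.lsc hE.ne_bot).comp
      (continuous_extend γ)
    refine Continuous.comp_lowerSemicontinuous (g := fun r : ℝ≥0∞ => ENNReal.ofReal (ε ^ 2) * r ^ 2)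
      ?_ hslope fun r r' hr => by dsimp only; gcongr
    exact (ENNReal.continuous_const_mul ENNReal.ofReal_ne_top).comp (ENNReal.continuous_pow 2)
  have hac : AbsolutelyContinuousOnInterval (extend γ) 0 1 :=
    ((hv.mono fun _ => zero_le).glue (hw.mono fun _ => zero_le) hm0
      hm1).absolutelyContinuousOnInterval zero_le_one
  have hfisher : ENNReal.ofReal (ε ^ 2) * fisherInformation E γ ≤
      (1 / 2) * ∫⁻ t in Icc (0 : ℝ) 1, G t := by
    rw [fisherInformation, mul_left_comm, ← lintegral_const_mul' _ _ ENNReal.ofReal_ne_top]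
    dsimp only [G]
    gcongr with t
    exact slope_le_globalSlope hE.ne_bot hE.exists_ne_top _
  calc action E ε γ ≤ (1 / 2) * (∫⁻ t in Icc (0 : ℝ) 1, metricSpeed (extend γ) t ^ 2) +
        (1 / 2) * ∫⁻ t in Icc (0 : ℝ) 1, G t := by
        rw [action, kineticEnergy, if_pos hac]
        gcongr
    _ = (1 / 2) * ∫⁻ t in Icc (0 : ℝ) 1, (metricSpeed (extend γ) t ^ 2 + G t) := by
        rw [lintegral_add_right _ hG.measurable, mul_add]
    _ ≤ (1 / 2) * ENNReal.ofReal (v m - v 0 + (w 1 - w m)) := by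
        gcongr
        exact hv.lintegral_add_le hw hm0 hm1 hG
    _ = _ := by
        rw [ENNReal.ofReal_div_of_pos two_pos, ENNReal.ofReal_ofNat, one_div, mul_comm,
          div_eq_mul_inv]

/-- The recovery curve `t ↦ S_{η + ε min(t, 1 - t)} γ_t`: running the flow for the longest time in
the middle regularises `γ` while moving its endpoints only for the prescribed time `η`. -/
noncomputable def GeneratesEVIFlow.recoveryCurve (hE : GeneratesEVIFlow E lam) (hη : 0 ≤ η)
    (hε : 0 ≤ ε) (γ : Curve X) : Curve X where
  toFun t := semigroup E lam (η + ε * min (t : ℝ) (1 - t)) (γ t)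
  continuous_toFun := by
    refine hE.continuousOn_uncurry_semigroup.comp_continuous
      (f := fun t : unitInterval => (η + ε * min (t : ℝ) (1 - t), γ t)) (by fun_prop) fun t => ?_
    have : 0 ≤ min (t : ℝ) (1 - t) := le_min t.2.1 (sub_nonneg.2 t.2.2)
    exact ⟨mem_Ici.2 (by positivity), mem_univ _⟩

variable (hE : GeneratesEVIFlow E lam) (hη : 0 ≤ η)

theorem GeneratesEVIFlow.extend_recoveryCurve (hε : 0 ≤ ε) (γ : Curve X) {t : ℝ}
    (ht : t ∈ Icc (0 : ℝ) 1) :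
    extend (hE.recoveryCurve hη hε γ) t =
      semigroup E lam (η + ε * min t (1 - t)) (extend γ t) := by
  simp [extend, recoveryCurve, projIcc_of_mem zero_le_one ht]

theorem GeneratesEVIFlow.recoveryCurve_zero (hε : 0 ≤ ε) (γ : Curve X) :
    hE.recoveryCurve hη hε γ 0 = semigroup E lam η (γ 0) := by
  simp [recoveryCurve]

theorem GeneratesEVIFlow.recoveryCurve_one (hε : 0 ≤ ε) (γ : Curve X) :
    hE.recoveryCurve hη hε γ 1 = semigroup E lam η (γ 1) := by
  simp [recoveryCurve]

theorem GeneratesEVIFlow.energy_recoveryCurve_ne_top (hε : 0 < ε) (γ : Curve X)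
    (h0 : E (semigroup E lam η (γ 0)) ≠ ⊤) (h1 : E (semigroup E lam η (γ 1)) ≠ ⊤) {t : ℝ}
    (ht : t ∈ Icc (0 : ℝ) 1) : E (extend (hE.recoveryCurve hη hε.le γ) t) ≠ ⊤ := by
  rcases eq_or_ne t 0 with rfl | ht0
  · simpa [extend, hE.recoveryCurve_zero hη hε.le γ] using h0
  rcases eq_or_ne t 1 with rfl | ht1
  · simpa [extend, hE.recoveryCurve_one hη hε.le γ] using h1
  rw [hE.extend_recoveryCurve hη hε.le γ ht]
  have : 0 < min t (1 - t) := lt_min (ht.1.lt_of_ne' ht0) (sub_pos.2 (ht.2.lt_of_ne ht1))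
  exact hE.energy_semigroup_ne_top _ (by positivity)

theorem GeneratesEVIFlow.dist_recoveryCurve_sq_add_le (hε : 0 < ε) (γ : Curve X)
    (h0 : E (semigroup E lam η (γ 0)) ≠ ⊤) (h1 : E (semigroup E lam η (γ 1)) ≠ ⊤) {s t τ : ℝ}
    (hs : s ∈ Icc (0 : ℝ) 1) (ht : t ∈ Icc (0 : ℝ) 1) (hτ : 0 < τ)
    (hst : min s (1 - s) = min t (1 - t) + τ) :
    globalSlope E lam (extend (hE.recoveryCurve hη hε.le γ) s) ≠ ⊤ ∧
      dist (extend (hE.recoveryCurve hη hε.le γ) s)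
          (extend (hE.recoveryCurve hη hε.le γ) t) ^ 2 +
        τ ^ 2 * (ε ^ 2 *
          (globalSlope E lam (extend (hE.recoveryCurve hη hε.le γ) s)).toReal ^ 2) ≤
      Real.exp (4 * |lam| * (η + ε)) *
        (Real.exp (2 * |lam| * (η + ε)) * dist (extend γ s) (extend γ t) ^ 2 +
          2 * ε * τ * ((E (extend (hE.recoveryCurve hη hε.le γ) t)).toReal -
            (E (extend (hE.recoveryCurve hη hε.le γ) s)).toReal)) := by
  have hE_t := hE.energy_recoveryCurve_ne_top hη hε γ h0 h1 ht
  have htime : η + ε * min s (1 - s) = (η + ε * min t (1 - t)) + ε * τ := by rw [hst]; ring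
  have ht0 : 0 ≤ min t (1 - t) := le_min ht.1 (sub_nonneg.2 ht.2)
  have hle : η + ε * min t (1 - t) + ε * τ ≤ η + ε := by
    rw [← htime]
    gcongr
    exact mul_le_of_le_one_right hε.le ((min_le_left _ _).trans hs.2)
  rw [hE.extend_recoveryCurve hη hε.le γ hs, hE.extend_recoveryCurve hη hε.le γ ht, htime]
  rw [hE.extend_recoveryCurve hη hε.le γ ht] at hE_t
  refine ⟨hE.globalSlope_semigroup_ne_top _ (by positivity), ?_⟩
  have hpair := hE.dist_sq_add_globalSlope_sq_le (extend γ s) (extend γ t) (by positivity)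
    (by positivity) hle hE_t
  convert hpair using 1 <;> ring

theorem GeneratesEVIFlow.isEnergyFunction_recoveryCurve_left (hε : 0 < ε) {γ : Curve X}
    (h0 : E (semigroup E lam η (γ 0)) ≠ ⊤) (h1 : E (semigroup E lam η (γ 1)) ≠ ⊤) {v : ℝ → ℝ}
    (hv : IsEnergyFunction (extend γ) 0 v 0 1) :
    IsEnergyFunction (extend (hE.recoveryCurve hη hε.le γ))
      (fun t => ENNReal.ofReal (ε ^ 2) *
        globalSlope E lam (extend (hE.recoveryCurve hη hε.le γ) t) ^ 2)
      (fun t => Real.exp (4 * |lam| * (η + ε)) * (Real.exp (2 * |lam| * (η + ε)) * v t -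
        2 * ε * (E (extend (hE.recoveryCurve hη hε.le γ) t)).toReal)) 0 (1 / 2) := by
  refine isEnergyFunction_of_forall_lt fun s t hs hst ht => ⟨t, by simp, ?_⟩
  obtain ⟨hfin, hle⟩ := hE.dist_recoveryCurve_sq_add_le hη hε γ h0 h1 (s := t) (t := s)
    ⟨by linarith, by linarith⟩ ⟨hs, by linarith⟩ (sub_pos.2 hst)
    (by rw [min_eq_left (by linarith), min_eq_left (by linarith)]; ring)
  refine ⟨ENNReal.mul_ne_top ENNReal.ofReal_ne_top (ENNReal.pow_ne_top hfin), ?_⟩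
  rw [ENNReal.toReal_mul, ENNReal.toReal_ofReal (sq_nonneg ε), ENNReal.toReal_pow, dist_comm]
  refine hle.trans ?_
  rw [← mul_sub, mul_left_comm]
  gcongr
  have := mul_le_mul_of_nonneg_left (hv.dist_sq_le hs hst.le (by linarith))
    (Real.exp_pos (2 * |lam| * (η + ε))).le
  rw [dist_comm]
  linarith

theorem GeneratesEVIFlow.isEnergyFunction_recoveryCurve_right (hε : 0 < ε) {γ : Curve X}
    (h0 : E (semigroup E lam η (γ 0)) ≠ ⊤) (h1 : E (semigroup E lam η (γ 1)) ≠ ⊤) {v : ℝ → ℝ}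
    (hv : IsEnergyFunction (extend γ) 0 v 0 1) :
    IsEnergyFunction (extend (hE.recoveryCurve hη hε.le γ))
      (fun t => ENNReal.ofReal (ε ^ 2) *
        globalSlope E lam (extend (hE.recoveryCurve hη hε.le γ) t) ^ 2)
      (fun t => Real.exp (4 * |lam| * (η + ε)) * (Real.exp (2 * |lam| * (η + ε)) * v t +
        2 * ε * (E (extend (hE.recoveryCurve hη hε.le γ) t)).toReal)) (1 / 2) 1 := by
  refine isEnergyFunction_of_forall_lt fun s t hs hst ht => ⟨s, by simp, ?_⟩
  obtain ⟨hfin, hle⟩ := hE.dist_recoveryCurve_sq_add_le hη hε γ h0 h1 (s := s) (t := t)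
    ⟨by linarith, by linarith⟩ ⟨by linarith, ht⟩ (sub_pos.2 hst)
    (by rw [min_eq_right (by linarith), min_eq_right (by linarith)]; ring)
  refine ⟨ENNReal.mul_ne_top ENNReal.ofReal_ne_top (ENNReal.pow_ne_top hfin), ?_⟩
  rw [ENNReal.toReal_mul, ENNReal.toReal_ofReal (sq_nonneg ε), ENNReal.toReal_pow]
  refine hle.trans ?_
  rw [← mul_sub, mul_left_comm]
  gcongr
  have := mul_le_mul_of_nonneg_left (hv.dist_sq_le (by linarith) hst.le ht)
    (Real.exp_pos (2 * |lam| * (η + ε))).le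
  linarith

theorem GeneratesEVIFlow.action_recoveryCurve_le (hε : 0 < ε) {γ : Curve X}
    (hγ : kineticEnergy γ ≠ ⊤) (h0 : E (semigroup E lam η (γ 0)) ≠ ⊤)
    (h1 : E (semigroup E lam η (γ 1)) ≠ ⊤) :
    action E ε (hE.recoveryCurve hη hε.le γ) ≤ ENNReal.ofReal (Real.exp (4 * |lam| * (η + ε)) *
      (Real.exp (2 * |lam| * (η + ε)) * (kineticEnergy γ).toReal +
        ε * ((E (semigroup E lam η (γ 0))).toReal + (E (semigroup E lam η (γ 1))).toReal -
          2 * (E (extend (hE.recoveryCurve hη hε.le γ) (1 / 2))).toReal))) := by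
  obtain ⟨v, hv, hv0, hv1⟩ := exists_isEnergyFunction_of_kineticEnergy_ne_top hγ
  refine (hE.action_le_of_isEnergyFunction (by norm_num) (by norm_num)
    (hE.isEnergyFunction_recoveryCurve_left hη hε h0 h1 hv)
    (hE.isEnergyFunction_recoveryCurve_right hη hε h0 h1 hv)).trans_eq ?_
  have hstart : extend (hE.recoveryCurve hη hε.le γ) 0 = semigroup E lam η (γ 0) := by
    simp [extend, hE.recoveryCurve_zero hη hε.le γ]
  have hend : extend (hE.recoveryCurve hη hε.le γ) 1 = semigroup E lam η (γ 1) := by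
    simp [extend, hE.recoveryCurve_one hη hε.le γ]
  rw [hstart, hend, hv0, hv1]
  ring_nf

theorem GeneratesEVIFlow.uniformConv_recoveryCurve {ε η : ℕ → ℝ} (hε_nonneg : ∀ n, 0 ≤ ε n)
    (hε : Tendsto ε atTop (𝓝 0)) (hη_nonneg : ∀ n, 0 ≤ η n) (hη : Tendsto η atTop (𝓝 0))
    (γ : Curve X) :
    UniformConv (fun n => hE.recoveryCurve (hη_nonneg n) (hε_nonneg n) γ) γ := by
  have hcont : ContinuousOn (fun p : ℝ × unitInterval => semigroup E lam p.1 (γ p.2))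
      (Icc (0 : ℝ) 1 ×ˢ univ) :=
    hE.continuousOn_uncurry_semigroup.comp
      (f := fun p : ℝ × unitInterval => (p.1, γ p.2)) (by fun_prop)
      fun p hp => ⟨hp.1.1, mem_univ _⟩
  have huc := (isCompact_Icc.prod isCompact_univ).uniformContinuousOn_of_continuous hcont
  rw [Metric.uniformContinuousOn_iff] at huc
  rw [UniformConv, Metric.tendstoUniformly_iff]
  intro e he
  obtain ⟨δ, hδ, hd⟩ := huc e he
  have hsum : Tendsto (fun n => η n + ε n) atTop (𝓝 0) := by simpa using hη.add hε
  filter_upwards [hsum.eventually (gt_mem_nhds (lt_min hδ one_pos))] with n hn t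
  set r := η n + ε n * min (t : ℝ) (1 - t) with hr
  have hmin : 0 ≤ min (t : ℝ) (1 - t) := le_min t.2.1 (sub_nonneg.2 t.2.2)
  have hr0 : 0 ≤ r := add_nonneg (hη_nonneg n) (mul_nonneg (hε_nonneg n) hmin)
  have hr_lt : r < min δ 1 := by
    refine lt_of_le_of_lt ?_ hn
    rw [hr]
    gcongr
    exact mul_le_of_le_one_right (hε_nonneg n) ((min_le_left _ _).trans t.2.2)
  have hclose := hd (0, t) ⟨by simp, mem_univ _⟩ (r, t)
    ⟨⟨hr0, (hr_lt.trans_le (min_le_right _ _)).le⟩, mem_univ _⟩ (by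
      rw [dist_prod_same_right, dist_zero_left, Real.norm_of_nonneg hr0]
      exact hr_lt.trans_le (min_le_left _ _))
  simpa [semigroup_zero, recoveryCurve] using hclose

end RecoveryCurve

/-! ### Γ-convergence -/

/-- A notion of convergence of curves that is weaker than uniform convergence and along which
distances are lower semicontinuous, both between two points of a curve and from a point of a curve
to a fixed point of `X`. Uniform convergence and pointwise `σ`-convergence are the examples. -/
structure IsAdmissibleConv (conv : (ℕ → Curve X) → Curve X → Prop) : Prop where
  of_uniformConv : ∀ {u γ}, UniformConv u γ → conv u γ
  edist_le_liminf : ∀ {u γ}, conv u γ → ∀ s t,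
    edist (γ s) (γ t) ≤ liminf (fun n => edist (u n s) (u n t)) atTop
  edist_const_le_liminf : ∀ {u γ}, conv u γ → ∀ t z,
    edist (γ t) z ≤ liminf (fun n => edist (u n t) z) atTop

theorem isAdmissibleConv_uniformConv : IsAdmissibleConv (UniformConv (X := X)) where
  of_uniformConv := id
  edist_le_liminf h s t := ((h.tendsto_at s).edist (h.tendsto_at t)).liminf_eq.ge
  edist_const_le_liminf h t _ := ((h.tendsto_at t).edist tendsto_const_nhds).liminf_eq.ge

theorem SigmaAssumption.tendsto_of_tendsto {E : X → EReal} {σ : TopologicalSpace X}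
    (hσ : SigmaAssumption E σ) {u : ℕ → X} {z : X}
    (hu : Tendsto u atTop (@nhds X UniformSpace.toTopologicalSpace z)) :
    Tendsto u atTop (@nhds X σ z) := by
  refine tendsto_of_subseq_tendsto fun ns hns => ?_
  have hsub := hu.comp hns
  obtain ⟨z', φ, hφ, hz'⟩ := hσ.seq_compact _ (Metric.isBounded_range_of_tendsto _ hsub)
    (fun n => u (ns n)) fun n => mem_range_self (f := u ∘ ns) n
  have hdist : Tendsto (fun n => edist (u (ns (φ n))) z) atTop (𝓝 0) :=
    tendsto_iff_edist_tendsto_0.1 (hsub.comp hφ.tendsto_atTop)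
  have hz'z : edist z' z ≤ 0 :=
    (hσ.dist_seq_lsc _ _ _ _ hz' (@tendsto_const_nhds X σ ℕ z atTop)).trans hdist.liminf_eq.le
  exact ⟨φ, edist_le_zero.1 hz'z ▸ hz'⟩

theorem SigmaAssumption.isAdmissibleConv_pointwiseConv {E : X → EReal} {σ : TopologicalSpace X}
    (hσ : SigmaAssumption E σ) : IsAdmissibleConv (PointwiseConv σ) where
  of_uniformConv h t := hσ.tendsto_of_tendsto (h.tendsto_at t)
  edist_le_liminf h s t := hσ.dist_seq_lsc _ _ _ _ (h s) (h t)
  edist_const_le_liminf h t z := hσ.dist_seq_lsc _ _ _ _ (h t) (@tendsto_const_nhds X σ ℕ z atTop)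

theorem endpointIndicator_ne_top_iff {x y : X} {γ : Curve X} :
    endpointIndicator x y γ ≠ ⊤ ↔ γ 0 = x ∧ γ 1 = y := by
  simp [endpointIndicator]

theorem eq_of_frequently_eq_of_edist_le_liminf {u v : ℕ → X} {p z : X}
    (hu : edist p z ≤ liminf (fun n => edist (u n) z) atTop) (hv : Tendsto v atTop (𝓝 z))
    (heq : ∃ᶠ n in atTop, u n = v n) : p = z := by
  rw [← edist_le_zero]
  refine hu.trans (le_of_forall_gt_imp_ge_of_dense fun c hc => liminf_le_of_frequently_le' ?_)
  have hclose : ∀ᶠ n in atTop, edist (v n) z < c :=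
    (tendsto_iff_edist_tendsto_0.1 hv).eventually (gt_mem_nhds hc)
  exact (heq.and_eventually hclose).mono fun n hn => hn.1 ▸ hn.2.le

theorem IsAdmissibleConv.le_liminf_action_add_endpointIndicator
    {conv : (ℕ → Curve X) → Curve X → Prop} (hconv : IsAdmissibleConv conv) {E : X → EReal}
    {ε : ℕ → ℝ} {x y : X} {xs ys : ℕ → X} (hx : Tendsto xs atTop (𝓝 x))
    (hy : Tendsto ys atTop (𝓝 y)) {u : ℕ → Curve X} {γ : Curve X} (hu : conv u γ) :
    kineticEnergy γ + endpointIndicator x y γ ≤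
      liminf (fun n => action E (ε n) (u n) + endpointIndicator (xs n) (ys n) (u n)) atTop := by
  by_cases htop : liminf (fun n => action E (ε n) (u n) +
      endpointIndicator (xs n) (ys n) (u n)) atTop = ⊤
  · exact htop ▸ le_top
  have hends : ∃ᶠ n in atTop, u n 0 = xs n ∧ u n 1 = ys n :=
    (frequently_lt_of_liminf_lt (by isBoundedDefault) (lt_top_iff_ne_top.2 htop)).mono fun n hn =>
      endpointIndicator_ne_top_iff.1 (ne_top_of_le_ne_top hn.ne le_add_self)
  have h0 : γ 0 = x := eq_of_frequently_eq_of_edist_le_liminf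
    (hconv.edist_const_le_liminf hu 0 x) hx (hends.mono fun n hn => hn.1)
  have h1 : γ 1 = y := eq_of_frequently_eq_of_edist_le_liminf
    (hconv.edist_const_le_liminf hu 1 y) hy (hends.mono fun n hn => hn.2)
  rw [endpointIndicator, if_pos ⟨h0, h1⟩, add_zero]
  refine (kineticEnergy_le_liminf (hconv.edist_le_liminf hu)).trans
    (liminf_le_liminf (Eventually.of_forall fun n => ?_))
  exact (le_self_add : kineticEnergy (u n) ≤ action E (ε n) (u n)).trans le_self_add

theorem eventually_ne_top_and_tendsto_toReal {ε : ℕ → ℝ} {a b : ℕ → EReal} (ha : ∀ n, a n ≠ ⊥)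
    (hb : ∀ n, b n ≠ ⊥) (hε_pos : ∀ n, 0 < ε n)
    (h : Tendsto (fun n => (ε n : EReal) * (a n + b n)) atTop (𝓝 0)) :
    (∀ᶠ n in atTop, a n ≠ ⊤ ∧ b n ≠ ⊤) ∧
      Tendsto (fun n => ε n * ((a n).toReal + (b n).toReal)) atTop (𝓝 0) := by
  have hfin : ∀ᶠ n in atTop, a n ≠ ⊤ ∧ b n ≠ ⊤ := by
    filter_upwards [h.eventually (gt_mem_nhds EReal.zero_lt_top)] with n hn
    have hsum : a n + b n ≠ ⊤ := fun htop =>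
      hn.ne (by rw [htop, EReal.coe_mul_top_of_pos (hε_pos n)])
    exact ⟨fun htop => hsum (by rw [htop, EReal.top_add_of_ne_bot (hb n)]),
      fun htop => hsum (by rw [htop, EReal.add_top_of_ne_bot (ha n)])⟩
  refine ⟨hfin, ?_⟩
  rw [← EReal.tendsto_coe]
  refine h.congr' ?_
  filter_upwards [hfin] with n hn
  rw [EReal.coe_mul, EReal.coe_add, EReal.coe_toReal hn.1 (ha n), EReal.coe_toReal hn.2 (hb n)]

theorem exists_eventually_lt_of_lowerSemicontinuous {E : X → EReal} (hlsc : LowerSemicontinuous E)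
    {z : X} (hz : E z ≠ ⊥) : ∃ c : ℝ, ∀ᶠ x in 𝓝 z, (c : EReal) < E x := by
  obtain ⟨c, -, hc⟩ := EReal.lt_iff_exists_real_btwn.1 (bot_lt_iff_ne_bot.2 hz)
  exact ⟨c, hlsc z c hc⟩

section Recovery

variable {E : X → EReal} {lam : ℝ} {ε η : ℕ → ℝ} (hE : GeneratesEVIFlow E lam)
  (hε_pos : ∀ n, 0 < ε n) (hε : Tendsto ε atTop (𝓝 0))
  (hη_nonneg : ∀ n, 0 ≤ η n) (hη : Tendsto η atTop (𝓝 0))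
include hE hη_nonneg hη

theorem GeneratesEVIFlow.tendsto_semigroup (x : X) :
    Tendsto (fun n => semigroup E lam (η n) x) atTop (𝓝 x) := by
  have h := (hE.continuousOn_semigroup x 0 (mem_Ici.2 le_rfl)).tendsto.comp
    (tendsto_nhdsWithin_iff.2 ⟨hη, Eventually.of_forall hη_nonneg⟩)
  simpa [Function.comp_def, semigroup_zero] using h

include hε

theorem GeneratesEVIFlow.exists_eventually_action_recoveryCurve_le {γ : Curve X}
    (hγ : kineticEnergy γ ≠ ⊤) (hfin : ∀ᶠ n in atTop, E (semigroup E lam (η n) (γ 0)) ≠ ⊤ ∧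
      E (semigroup E lam (η n) (γ 1)) ≠ ⊤) :
    ∃ c : ℝ, ∀ᶠ n in atTop, action E (ε n) (hE.recoveryCurve (hη_nonneg n) (hε_pos n).le γ) ≤
      ENNReal.ofReal (Real.exp (4 * |lam| * (η n + ε n)) *
        (Real.exp (2 * |lam| * (η n + ε n)) * (kineticEnergy γ).toReal +
          ε n * ((E (semigroup E lam (η n) (γ 0))).toReal +
            (E (semigroup E lam (η n) (γ 1))).toReal - 2 * c))) := by
  set ρ : ℕ → Curve X := fun n => hE.recoveryCurve (hη_nonneg n) (hε_pos n).le γ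
  obtain ⟨c, hc⟩ := exists_eventually_lt_of_lowerSemicontinuous hE.lsc
    (hE.ne_bot (extend γ (1 / 2)))
  have hρ : UniformConv ρ γ :=
    hE.uniformConv_recoveryCurve (fun n => (hε_pos n).le) hε hη_nonneg hη γ
  refine ⟨c, ?_⟩
  filter_upwards [hfin, (hρ.tendsto_at _).eventually hc] with n hn hmid
  refine (hE.action_recoveryCurve_le (hη_nonneg n) (hε_pos n) hγ hn.1 hn.2).trans ?_
  have hmid_ne_top := hE.energy_recoveryCurve_ne_top (hη_nonneg n) (hε_pos n) γ hn.1 hn.2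
    (t := 1 / 2) (by norm_num)
  have hmid_le : c ≤ (E (extend (ρ n) (1 / 2))).toReal := by
    rw [← EReal.coe_le_coe_iff, EReal.coe_toReal hmid_ne_top (hE.ne_bot _)]
    exact hmid.le
  have := (hε_pos n).le
  gcongr

theorem GeneratesEVIFlow.limsup_action_recoveryCurve_le {γ : Curve X} (hγ : kineticEnergy γ ≠ ⊤)
    (hslow : Tendsto (fun n => (ε n : EReal) *
      (E (semigroup E lam (η n) (γ 0)) + E (semigroup E lam (η n) (γ 1)))) atTop (𝓝 0)) :
    limsup (fun n => action E (ε n) (hE.recoveryCurve (hη_nonneg n) (hε_pos n).le γ)) atTop ≤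
      kineticEnergy γ := by
  obtain ⟨hfin, hends⟩ := eventually_ne_top_and_tendsto_toReal (fun _ => hE.ne_bot _)
    (fun _ => hE.ne_bot _) hε_pos hslow
  obtain ⟨c, hbound⟩ :=
    hE.exists_eventually_action_recoveryCurve_le hε_pos hε hη_nonneg hη hγ hfin
  have hexp : ∀ k : ℝ, Tendsto (fun n => Real.exp (k * (η n + ε n))) atTop (𝓝 1) := fun k => by
    simpa using ((hη.add hε).const_mul k).rexp
  have hlim := (hexp (4 * |lam|)).mul
    (((hexp (2 * |lam|)).mul_const (kineticEnergy γ).toReal).add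
      (hends.sub (hε.mul_const (2 * c))))
  simp only [← mul_sub, zero_mul, sub_zero, one_mul, add_zero] at hlim
  calc _ ≤ _ := limsup_le_limsup hbound
    _ = ENNReal.ofReal (kineticEnergy γ).toReal := (ENNReal.tendsto_ofReal hlim).limsup_eq
    _ = kineticEnergy γ := ENNReal.ofReal_toReal hγ

include hε_pos

theorem GeneratesEVIFlow.exists_recovery_sequence (x y : X)
    (hslow : Tendsto (fun n => (ε n : EReal) *
      (E (semigroup E lam (η n) x) + E (semigroup E lam (η n) y))) atTop (𝓝 0)) (γ : Curve X) :
    ∃ u : ℕ → Curve X, UniformConv u γ ∧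
      limsup (fun n => action E (ε n) (u n) +
        endpointIndicator (semigroup E lam (η n) x) (semigroup E lam (η n) y) (u n)) atTop ≤
      kineticEnergy γ + endpointIndicator x y γ := by
  by_cases htop : kineticEnergy γ + endpointIndicator x y γ = ⊤
  · exact ⟨fun _ => γ, fun _ hs => Eventually.of_forall fun _ _ => refl_mem_uniformity hs,
      htop ▸ le_top⟩
  obtain ⟨hγ, hends⟩ := ENNReal.add_ne_top.1 htop
  obtain ⟨rfl, rfl⟩ := endpointIndicator_ne_top_iff.1 hends
  refine ⟨_, hE.uniformConv_recoveryCurve (fun n => (hε_pos n).le) hε hη_nonneg hη γ, ?_⟩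
  simpa [endpointIndicator, hE.recoveryCurve_zero, hE.recoveryCurve_one] using
    hE.limsup_action_recoveryCurve_le hε_pos hε hη_nonneg hη hγ hslow

end Recovery

end MetricSchrodinger

open MetricSchrodinger in
theorem theorem4p5_general {X : Type*} [MetricSpace X] {E : X → EReal} {lam : ℝ}
    (hE : GeneratesEVIFlow E lam) (x y : X)
    {ε η : ℕ → ℝ} (hε_pos : ∀ n, 0 < ε n) (hε : Tendsto ε atTop (𝓝 0))
    (hη_nonneg : ∀ n, 0 ≤ η n) (hη : Tendsto η atTop (𝓝 0))
    (hslow : Tendsto (fun n => (ε n : EReal) *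
      (E (semigroup E lam (η n) x) + E (semigroup E lam (η n) y))) atTop (𝓝 0))
    {conv : (ℕ → Curve X) → Curve X → Prop} (hconv : IsAdmissibleConv conv) :
    GammaConverges conv
      (fun n (γ : Curve X) => action E (ε n) γ +
        endpointIndicator (semigroup E lam (η n) x) (semigroup E lam (η n) y) γ)
      (fun γ => kineticEnergy γ + endpointIndicator x y γ) := by
  refine ⟨fun u γ hu => ?_, fun γ => ?_⟩
  · exact hconv.le_liminf_action_add_endpointIndicator
      (hE.tendsto_semigroup hη_nonneg hη x) (hE.tendsto_semigroup hη_nonneg hη y) hu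
  · obtain ⟨u, hu, hle⟩ := hE.exists_recovery_sequence hε_pos hε hη_nonneg hη x y hslow γ
    exact ⟨u, hconv.of_uniformConv hu, hle⟩

open MetricSchrodinger in
theorem theorem4p5 {X : Type*} [MetricSpace X] [CompleteSpace X]
    [TopologicalSpace.SeparableSpace X] (E : X → EReal) (lam : ℝ)
    (hE : StandingAssumptions E lam) (x y : X)
    (ε η : ℕ → ℝ) (hε_pos : ∀ n, 0 < ε n) (hε : Tendsto ε atTop (𝓝 0))
    (hη_nonneg : ∀ n, 0 ≤ η n) (hη : Tendsto η atTop (𝓝 0))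
    (hslow : Tendsto (fun n => (ε n : EReal) *
      (E (semigroup E lam (η n) x) + E (semigroup E lam (η n) y))) atTop (𝓝 0)) :
    GammaConverges UniformConv
      (fun n (γ : Curve X) => action E (ε n) γ +
        endpointIndicator (semigroup E lam (η n) x) (semigroup E lam (η n) y) γ)
      (fun γ => kineticEnergy γ + endpointIndicator x y γ) ∧
    ∀ σ : TopologicalSpace X, SigmaAssumption E σ →
      GammaConverges (PointwiseConv σ)
        (fun n (γ : Curve X) => action E (ε n) γ +
          endpointIndicator (semigroup E lam (η n) x) (semigroup E lam (η n) y) γ)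
        (fun γ => kineticEnergy γ + endpointIndicator x y γ) :=
  have : Nonempty X := ⟨x⟩
  have gammaConverges {conv} (hconv : IsAdmissibleConv conv) :=
    theorem4p5_general hE.generatesEVIFlow x y hε_pos hε hη_nonneg hη hslow hconv
  ⟨gammaConverges isAdmissibleConv_uniformConv,
    fun _ hσ => gammaConverges hσ.isAdmissibleConv_pointwiseConv⟩
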